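/- Let $X_1,\dots,X_m$, $m\ge 2$, and $Y$ be Banach spaces over $\mathbb K=\mathbb R$ or $\mathbb C$. For a sequence $x=(x_i)_{i\in\mathbb N}$ in a Banach space $X$ and $p\ge1$ put $w_p(x)=\sup_{\|x^*\|\le 1}\big(\sum_{i}|x^*(x_i)|^p\big)^{1/p}\in[0,\infty]$, the supremum being over the closed unit ball of $X^*$. For a finite index set $I$, an $|I|$-linear map $S:\prod_{j\in I}X_j\to Y$ is multiple $(r,\mathbf p)$-summing, $\mathbf p=(p_j)_{j\in I}$, if there is a constant $K>0$ with $$\Big(\sum_{\mathbf i\in\mathbb N^{I}}\big\|S\big((x_{i_j}(j))_{j\in I}\big)\big\|^r\Big)^{1/r}\le K\prod_{j\in I}w_{p_j}(x(j))$$ for all sequences $x(j)\in X_j^{\mathbb N}$, $j\in I$. For $C\subset\{1,\dots,m\}$, an $m$-linear map $T:X_1\times\cdots\times X_m\to Y$ is coordinatewise multiple $(r,p)$-summing in the coordinates of $C$ if, for every $z\in\prod_{j\notin C}X_j$, the $|C|$-linear map $y\mapsto T(y,z)$ on $\prod_{j\in C}X_j$ is multiple $(r,(p,\dots,p))$-summing.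 $Y$ has cotype $q\in[2,\infty)$ if there is a constant $K>0$ with $(\sum_{i=1}^N\|y_i\|^q)^{1/q}\le K\,(\mathbb E\|\sum_{i=1}^N\varepsilon_iy_i\|^2)^{1/2}$ for all $N$ and $y_1,\dots,y_N\in Y$, where the $\varepsilon_i$ are independent uniform random signs. Write $1/p^*=1-1/p$ for $p\in[1,\infty)$. Theorem 2.1. Let $\{1,\dots,m\}$ be the disjoint union of $n\ge2$ non-empty subsets $C_1,\dots,C_n$, let $Y$ have cotype $q$, and let $r_1,\dots,r_n\in[1,q)$, $p_1,\dots,p_n\in[1,\infty)$. Define $$\frac1{\gamma_k}=\frac1{r_k}-\sum_{j\ne k}\frac{|C_j|}{p_j^*}\cdot\frac{1-\frac q{r_k}-\frac{q|C_k|}{p_k^*}}{1-\frac q{r_j}-\frac{q|C_j|}{p_j^*}}\quad(1\le k\le n),$$ $$\frac1{\gamma_{k,l}}=\frac1{r_k}-\sum_{j\ne k,l}\frac{|C_j|}{p_j^*}\cdot\frac{1-\frac q{r_k}-\frac{q|C_k|}{p_k^*}}{1-\frac q{r_j}-\frac{q|C_j|}{p_j^*}}\quad(k\ne l),$$ and assume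 that, for all $k\ne l$ in $\{1,\dots,n\}$, $0<\gamma_k<q$, $0<\gamma_{k,l}\le q$ and $\frac{|C_l|\gamma_{k,l}}{p_l^*}\le1$. Put $$R=\sum_{k=1}^n\frac{\gamma_k}{q-\gamma_k},\qquad s=\frac{qR}{1+R},$$ and $\mathbf q=(q_1,\dots,q_m)$ with $q_j=p_k$ for $j\in C_k$. Then every $m$-linear map $T:X_1\times\cdots\times X_m\to Y$ that is coordinatewise multiple $(r_k,p_k)$-summing in the coordinates of $C_k$ for each $k=1,\dots,n$ is multiple $(s,\mathbf q)$-summing. -/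

import Mathlib

open scoped ENNReal

noncomputable section

/-- The weak `ℓ^p`-norm `w_p(x) = sup_{‖φ‖ ≤ 1} (∑ |φ(x_i)|^p)^{1/p}` of a sequence, with values
in `[0, ∞]`; `φ` runs over the closed unit ball of the topological dual. -/
def weakNorm (𝕜 : Type*) [RCLike 𝕜] {X : Type*} [NormedAddCommGroup X] [NormedSpace 𝕜 X]
    (p : ℝ) (x : ℕ → X) : ℝ≥0∞ :=
  ⨆ (φ : X →L[𝕜] 𝕜) (_ : ‖φ‖ ≤ 1), (∑' i, ‖φ (x i)‖ₑ ^ p) ^ (1 / p)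

/-- `T` is multiple `(r, 𝐩)`-summing: for some finite constant `K > 0` and all sequences
`x j` in `X j`, `(∑_{i ∈ ℕ^ι} ‖T(x_i)‖^r)^{1/r} ≤ K ∏ⱼ w_{pⱼ}(x j)`, the sums being taken in
`[0, ∞]` (if the right side is `∞` because of one factor while another factor is `0`, the
left side is `0` too, so that the convention `∞ * 0 = 0` is harmless). -/
def IsMultipleSumming {𝕜 : Type*} [RCLike 𝕜] {ι : Type*} [Fintype ι]
    {X : ι → Type*} [∀ j, NormedAddCommGroup (X j)] [∀ j, NormedSpace 𝕜 (X j)]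
    {Y : Type*} [NormedAddCommGroup Y] [NormedSpace 𝕜 Y]
    (r : ℝ) (p : ι → ℝ) (T : MultilinearMap 𝕜 X Y) : Prop :=
  ∃ K : ℝ, 0 < K ∧ ∀ x : (j : ι) → ℕ → X j,
    (∑' i : ι → ℕ, ‖T (fun j => x j (i j))‖ₑ ^ r) ^ (1 / r)
      ≤ ENNReal.ofReal K * ∏ j, weakNorm 𝕜 (p j) (x j)

/-- `T` is coordinatewise multiple `(r, p)`-summing in the coordinates of `C`: for every choice
`z` of the coordinates outside `C`, the `|C|`-linear map `y ↦ T(y, z)` is multiple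
`(r, (p, …, p))`-summing. -/
def IsCoordinatewiseSumming {𝕜 : Type*} [RCLike 𝕜] {ι : Type*} [Fintype ι] [DecidableEq ι]
    {X : ι → Type*} [∀ j, NormedAddCommGroup (X j)] [∀ j, NormedSpace 𝕜 (X j)]
    {Y : Type*} [NormedAddCommGroup Y] [NormedSpace 𝕜 Y]
    (C : Finset ι) (r p : ℝ) (T : MultilinearMap 𝕜 X Y) : Prop :=
  ∀ z : (j : {a : ι // ¬ a ∈ C}) → X j,
    IsMultipleSumming r (fun _ => p) (T.domDomRestrict (fun a => a ∈ C) z)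

/-- `Y` has cotype `q` (`2 ≤ q < ∞`): for some constant `K > 0` and all finite families
`y₁, …, y_N` in `Y`, `(∑ ‖y_i‖^q)^{1/q} ≤ K (𝔼 ‖∑ ε_i y_i‖²)^{1/2}`, where the `ε_i` are
independent uniform signs; the expectation is the average over the `2^N` choices of signs. -/
def HasCotype (Y : Type*) [NormedAddCommGroup Y] (q : ℝ) : Prop :=
  2 ≤ q ∧ ∃ K : ℝ, 0 < K ∧ ∀ (N : ℕ) (y : Fin N → Y),
    (∑ i, ‖y i‖ ^ q) ^ (1 / q)
      ≤ K * Real.sqrt ((∑ ε : Fin N → Bool, ‖∑ i, (if ε i then y i else -y i)‖ ^ 2) / 2 ^ N)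

/-- The reciprocal `1 / p^*` of the conjugate exponent of `p ∈ [1, ∞)`, that is `1 - 1 / p`
(it is `0` when `p = 1`, i.e. `p^* = ∞`). -/
def invConj (p : ℝ) : ℝ := 1 - 1 / p

/-- The quantity `1 - q / r - q c / p^*`. -/
def blockFactor (q r p : ℝ) (c : ℕ) : ℝ := 1 - q / r - q * c * invConj p

end

/-! Fix sequences with weak norms at most 1 and study the array b = (‖T x_i‖/A)^q, with the sums
over the fibers of the projections of multi-indices to the blocks C_k. Cotype replaces an ℓ^q-sum
over an index outside C_k by an average over signs, and multilinearity moves the signed sum inside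
T. If signed sums in the coordinates outside C_k stay in the unit ball, coordinatewise summability
in C_k gives an ℓ^{r_k}(ℓ^q) estimate (`sum_boxOver_le`). Banach–Steinhaus makes its constant
independent of the frozen vectors.

Weak p-summability bounds signed sums only for p = 1. For p > 1 the vectors are multiplied by
weights from the unit ball of ℓ^{p^*}, written as u^{1/p^*} with u of mass at most 1. Hence the
estimates hold for every weighted array ∏_l u_l^{c_l} b with c_l = q|C_l|/p_l^*
(`weighted_mixed_estimate`); with the weight of block k included, the exponent is 1/(1+θ_k), where
θ_k = q/r_k + c_k - 1.

The weights are then removed block by block by testing with nearly extremal u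
(`sum_rpow_fiberSum_le_one_of_weighted`). Each removal subtracts c_l/θ_l from a factor of θ_k common
to all k, so θ_k finally becomes θ_k(1-S) with S = ∑ c_l/θ_l. Since 1 + θ_k(1-S) = q/γ_k, the
exponents γ_k appear. The Blei-type inequality `sum_rpow_le_one_of_fiberSum` merges the n mixed
estimates into summability of b^{R/(1+R)}, and qR/(1+R) = s. -/

/-- The sum of `b` over the fiber of `π` above `v`. -/
def fiberSum {I V : Type*} [Fintype I] [DecidableEq V] (π : I → V) (b : I → ℝ) (v : V) : ℝ :=
  ∑ i with π i = v, b i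

/-! ### Weighted arrays and the removal of a single weight. -/

section Arrays

variable {I V W : Type*} [Fintype I] [DecidableEq V] [DecidableEq W]

lemma fiberSum_nonneg (π : I → V) {b : I → ℝ} (hb : ∀ i, 0 ≤ b i) (v : V) :
    0 ≤ fiberSum π b v :=
  Finset.sum_nonneg fun i _ => hb i

lemma le_fiberSum (π : I → V) {b : I → ℝ} (hb : ∀ i, 0 ≤ b i) (i : I) :
    b i ≤ fiberSum π b (π i) :=
  Finset.single_le_sum (f := b) (fun i _ => hb i) (by simp)

lemma fiberSum_mul_comp (π : I → V) (g : V → ℝ) (b : I → ℝ) (v : V) :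
    fiberSum π (fun i => g (π i) * b i) v = g v * fiberSum π b v := by
  unfold fiberSum
  rw [Finset.mul_sum]
  refine Finset.sum_congr rfl fun i hi => ?_
  simp only [(Finset.mem_filter.1 hi).2]

variable [Fintype V] [Fintype W]

lemma sum_fiberSum (π : I → V) (b : I → ℝ) : ∑ v, fiberSum π b v = ∑ i, b i :=
  Finset.sum_fiberwise _ _ _

/-- On a fiber the first factor is constant, so the fiber contributes X^(e-1) · X; fibers of mass
zero are harmless because e > 0. This turns a mixed norm bound into an ℓ^1 bound for a reweighted
array. -/
lemma sum_mul_rpow_fiberSum (π : I → V) {b : I → ℝ} (hb : ∀ i, 0 ≤ b i) {e : ℝ} (he : 0 < e) :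
    ∑ i, fiberSum π b (π i) ^ (e - 1) * b i = ∑ v, fiberSum π b v ^ e := by
  rw [← sum_fiberSum π]
  refine Finset.sum_congr rfl fun v _ => ?_
  rw [fiberSum_mul_comp π (fun v => fiberSum π b v ^ (e - 1))]
  rcases (fiberSum_nonneg π hb v).eq_or_lt with h | h
  · rw [← h, mul_zero, Real.zero_rpow he.ne']
  · rw [Real.rpow_sub_one h.ne']
    field_simp

/-- Hölder's inequality in weighted form. -/
lemma sum_rpow_mul_rpow_le {ι : Type*} (s : Finset ι) {a b : ι → ℝ} (ha : ∀ i, 0 ≤ a i)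
    (hb : ∀ i, 0 ≤ b i) {t : ℝ} (ht₀ : 0 ≤ t) (ht₁ : t < 1) :
    ∑ i ∈ s, a i ^ (1 - t) * b i ^ t ≤ (∑ i ∈ s, a i) ^ (1 - t) * (∑ i ∈ s, b i) ^ t := by
  rcases ht₀.eq_or_lt with rfl | ht
  · simp
  have hpq : (1 / (1 - t)).HolderConjugate (1 / t) := by
    rw [Real.holderConjugate_iff]
    refine ⟨by rw [lt_div_iff₀] <;> linarith, by simp⟩
  have h := Real.inner_le_Lp_mul_Lq_of_nonneg s (f := fun i => a i ^ (1 - t))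
    (g := fun i => b i ^ t) hpq (fun i _ => Real.rpow_nonneg (ha i) _)
    (fun i _ => Real.rpow_nonneg (hb i) _)
  have h1 : 1 - t ≠ 0 := by linarith
  simpa [← Real.rpow_mul, ha, hb, h1, ht.ne'] using h

/-- Removing a weight which depends only on the fiber. -/
lemma sum_rpow_fiberSum_le_one_of_own (π : I → V) {b : I → ℝ} (hb : ∀ i, 0 ≤ b i) {h c : ℝ}
    (hc : 0 ≤ c) (hch : c < 1 + h)
    (H : ∀ u : V → ℝ, (∀ v, 0 ≤ u v) → ∑ v, u v ≤ 1 →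
      ∑ v, fiberSum π (fun i => u (π i) ^ c * b i) v ^ (1 / (1 + h)) ≤ 1) :
    ∑ v, fiberSum π b v ^ (1 / (1 + (h - c))) ≤ 1 := by
  have hX := fiberSum_nonneg π hb
  set X := fiberSum π b
  set e₁ := 1 / (1 + (h - c)) with he₁
  set Z := ∑ v, X v ^ e₁ with hZ
  have hZ0 : 0 ≤ Z := Finset.sum_nonneg fun v _ => Real.rpow_nonneg (hX v) _
  rcases hZ0.eq_or_lt with h0 | hZpos
  · rw [← h0]; exact zero_le_one
  have hu : ∀ v, 0 ≤ X v ^ e₁ / Z := fun v => div_nonneg (Real.rpow_nonneg (hX v) _) hZ0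
  -- This weight has mass 1 and makes each weighted term proportional to X^e₁. The hypothesis
  -- becomes Z ≤ Z^(c/(1+h)), which forces Z ≤ 1 since c < 1 + h.
  have key := H (fun v => X v ^ e₁ / Z) hu (by rw [← Finset.sum_div, ← hZ, div_self hZpos.ne'])
  have hpos : 0 < 1 + (h - c) := by linarith
  have hpos' : 0 < 1 + h := by linarith
  have hterm : ∀ v, fiberSum π (fun i => (X (π i) ^ e₁ / Z) ^ c * b i) v ^ (1 / (1 + h))
      = X v ^ e₁ / Z ^ (c / (1 + h)) := by
    intro v
    rw [fiberSum_mul_comp π (fun v => (X v ^ e₁ / Z) ^ c)]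
    change ((X v ^ e₁ / Z) ^ c * X v) ^ (1 / (1 + h)) = _
    rcases (hX v).eq_or_lt with h0 | h0
    · rw [← h0, mul_zero, Real.zero_rpow (by positivity), Real.zero_rpow (by positivity), zero_div]
    · rw [Real.mul_rpow (Real.rpow_nonneg (hu v) _) h0.le, ← Real.rpow_mul (hu v),
        Real.div_rpow (by positivity) hZ0, ← Real.rpow_mul h0.le, div_mul_eq_mul_div,
        ← Real.rpow_add h0]
      congr 2
      · rw [he₁]; field_simp; ring
      · ring
  simp only [hterm] at key
  rw [← Finset.sum_div, ← hZ, div_le_one (by positivity)] at key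
  by_contra hlt
  push Not at hlt
  have : Z ^ (c / (1 + h)) < Z ^ (1 : ℝ) :=
    Real.rpow_lt_rpow_of_exponent_lt hlt (by rw [div_lt_one hpos']; exact hch)
  rw [Real.rpow_one] at this
  linarith

/-- Removing a weight which depends on another projection. -/
lemma sum_rpow_fiberSum_le_one_of_cross (π : I → V) (f : I → W) {b : I → ℝ} (hb : ∀ i, 0 ≤ b i)
    {h h' c : ℝ} (hh : 0 ≤ h) (hh' : 0 < h') (hc : 0 ≤ c)
    (Hf : ∑ w, fiberSum f b w ^ (1 / (1 + h')) ≤ 1)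
    (H : ∀ u : W → ℝ, (∀ w, 0 ≤ u w) → ∑ w, u w ≤ 1 →
      ∑ v, fiberSum π (fun i => u (f i) ^ c * b i) v ^ (1 / (1 + h)) ≤ 1) :
    ∑ v, fiberSum π b v ^ (1 / (1 + h * (1 - c / (h' + c)))) ≤ 1 := by
  have hB := fiberSum_nonneg f hb
  have hbB := le_fiberSum f hb
  have hsum := sum_mul_rpow_fiberSum f hb (e := 1 / (1 + h')) (by positivity)
  set B := fiberSum f b
  -- This t makes the powers of B cancel in A^(1-t) D^t, leaving exactly b.
  set t := c / (h' + c) with ht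
  have ht₀ : 0 ≤ t := by positivity
  have ht₁ : t < 1 := by rw [ht, div_lt_one (by positivity)]; linarith
  have ht₁' : 0 ≤ 1 - t := by linarith
  have key := H (fun w => B w ^ (1 / (1 + h'))) (fun w => Real.rpow_nonneg (hB w) _) Hf
  set A := fun i => (B (f i) ^ (1 / (1 + h'))) ^ c * b i with hA
  set D := fun i => B (f i) ^ (1 / (1 + h') - 1) * b i with hD
  have hA0 : ∀ i, 0 ≤ A i := fun i =>
    mul_nonneg (Real.rpow_nonneg (Real.rpow_nonneg (hB _) _) _) (hb i)
  have hD0 : ∀ i, 0 ≤ D i := fun i => mul_nonneg (Real.rpow_nonneg (hB _) _) (hb i)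
  have hbAD : ∀ i, b i ≤ A i ^ (1 - t) * D i ^ t := by
    intro i
    rcases (hb i).eq_or_lt with h0 | h0
    · rw [← h0]
      exact mul_nonneg (Real.rpow_nonneg (hA0 i) _) (Real.rpow_nonneg (hD0 i) _)
    have hBi : 0 < B (f i) := h0.trans_le (hbB i)
    refine le_of_eq ?_
    simp only [hA, hD]
    rw [Real.mul_rpow (by positivity) h0.le, Real.mul_rpow (by positivity) h0.le,
      ← Real.rpow_mul hBi.le, ← Real.rpow_mul hBi.le, ← Real.rpow_mul hBi.le,
      mul_mul_mul_comm, ← Real.rpow_add hBi, ← Real.rpow_add h0]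
    have e1 : 1 / (1 + h') * c * (1 - t) + (1 / (1 + h') - 1) * t = 0 := by
      rw [ht]; field_simp; ring
    rw [e1]
    simp
  have hX : ∀ v, fiberSum π b v ≤ fiberSum π A v ^ (1 - t) * fiberSum π D v ^ t := fun v =>
    (Finset.sum_le_sum fun i _ => hbAD i).trans (sum_rpow_mul_rpow_le _ hA0 hD0 ht₀ ht₁)
  have hAf := fiberSum_nonneg π hA0
  have hDf := fiberSum_nonneg π hD0
  have hden : 0 < 1 + h * (1 - t) := by positivity
  set g := 1 / (1 + h * (1 - t)) with hg
  have hg0 : 0 < g := by positivity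
  -- The exponent g is the one for which the two coefficients add up to 1, so that weighted AM-GM
  -- gives a bound linear in the two quantities known to have sum at most 1.
  have hterm : ∀ v, fiberSum π b v ^ g ≤
      ((1 - t) * g * (1 + h)) * fiberSum π A v ^ (1 / (1 + h)) + t * g * fiberSum π D v := by
    intro v
    refine (Real.rpow_le_rpow (fiberSum_nonneg π hb v) (hX v) hg0.le).trans ?_
    rw [Real.mul_rpow (Real.rpow_nonneg (hAf v) _) (Real.rpow_nonneg (hDf v) _),
      ← Real.rpow_mul (hAf v), ← Real.rpow_mul (hDf v)]
    have := Real.geom_mean_le_arith_mean2_weighted (w₁ := (1 - t) * g * (1 + h)) (w₂ := t * g)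
      (p₁ := fiberSum π A v ^ (1 / (1 + h))) (p₂ := fiberSum π D v) (by positivity) (by positivity)
      (Real.rpow_nonneg (hAf v) _) (hDf v) (by rw [hg]; field_simp; ring)
    have e1 : 1 / (1 + h) * ((1 - t) * g * (1 + h)) = (1 - t) * g := by field_simp
    rwa [← Real.rpow_mul (hAf v), e1] at this
  calc ∑ v, fiberSum π b v ^ g
      ≤ ∑ v, (((1 - t) * g * (1 + h)) * fiberSum π A v ^ (1 / (1 + h))
          + t * g * fiberSum π D v) := Finset.sum_le_sum fun v _ => hterm v
    _ = ((1 - t) * g * (1 + h)) * ∑ v, fiberSum π A v ^ (1 / (1 + h)) + t * g * ∑ i, D i := by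
        rw [Finset.sum_add_distrib, ← Finset.mul_sum, ← Finset.mul_sum, sum_fiberSum]
    _ ≤ ((1 - t) * g * (1 + h)) * 1 + t * g * 1 := by
        gcongr
        exact hsum.trans_le Hf
    _ = 1 := by rw [hg]; field_simp; ring

end Arrays

/-! ### Removal of all weights, and the Blei-type inequality. -/

section Blocks

variable {I κ : Type*} [Fintype I] [Fintype κ] [DecidableEq κ] {V : κ → Type*}
  [∀ k, Fintype (V k)] [∀ k, DecidableEq (V k)]

/-- Mixed norm estimates which hold for all weighted versions of an array imply mixed norm
estimates for the array itself, with worse exponents. -/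
theorem sum_rpow_fiberSum_le_one_of_weighted (π : ∀ k, I → V k) {b : I → ℝ} (hb : ∀ i, 0 ≤ b i)
    {c θ : κ → ℝ} (hc : ∀ k, 0 ≤ c k) (hθ : ∀ k, 0 < θ k) (hS : ∑ k, c k / θ k < 1)
    (H : ∀ u : ∀ k, V k → ℝ, (∀ k v, 0 ≤ u k v) → (∀ k, ∑ v, u k v ≤ 1) → ∀ k,
      ∑ v, fiberSum (π k) (fun i => (∏ l, u l (π l i) ^ c l) * b i) v ^ (1 / (1 + θ k)) ≤ 1)
    (k : κ) :
    ∑ v, fiberSum (π k) b v ^ (1 / (1 + θ k * (1 - ∑ l, c l / θ l))) ≤ 1 := by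
  -- D collects the weights already removed; the others remain arbitrary, so that the next one can
  -- still be chosen freely.
  suffices Q : ∀ D : Finset κ, ∀ u : ∀ k, V k → ℝ, (∀ k v, 0 ≤ u k v) → (∀ k, ∑ v, u k v ≤ 1) →
      ∀ k, ∑ v, fiberSum (π k) (fun i => (∏ l ∈ Dᶜ, u l (π l i) ^ c l) * b i) v ^
        (1 / (1 + θ k * (1 - ∑ l ∈ D, c l / θ l))) ≤ 1 by
    simpa using Q Finset.univ (fun _ _ => 0) (by simp) (by simp) k
  intro D
  induction D using Finset.induction_on with
  | empty => simpa using H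
  | insert l D hl ih =>
    intro u hu hu1
    have hlam : ∑ j ∈ insert l D, c j / θ j < 1 := by
      refine lt_of_le_of_lt (Finset.sum_le_sum_of_subset_of_nonneg (Finset.subset_univ _) ?_) hS
      exact fun j _ _ => div_nonneg (hc j) (hθ j).le
    rw [Finset.sum_insert hl] at hlam ⊢
    have hcl : 0 ≤ c l / θ l := div_nonneg (hc l) (hθ l).le
    have hclθ : c l / θ l * θ l = c l := div_mul_cancel₀ _ (hθ l).ne'
    set σ := ∑ j ∈ D, c j / θ j with hσ
    set b' : I → ℝ := fun i => (∏ j ∈ (insert l D)ᶜ, u j (π j i) ^ c j) * b i with hb'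
    have hb'0 : ∀ i, 0 ≤ b' i := fun i =>
      mul_nonneg (Finset.prod_nonneg fun j _ => Real.rpow_nonneg (hu j _) _) (hb i)
    have hD : Dᶜ = insert l (insert l D)ᶜ := by
      ext j
      by_cases hj : j = l <;> simp [hj, hl]
    have hw : ∀ u' : V l → ℝ, (∀ v, 0 ≤ u' v) → ∑ v, u' v ≤ 1 → ∀ k,
        ∑ v, fiberSum (π k) (fun i => u' (π l i) ^ c l * b' i) v ^ (1 / (1 + θ k * (1 - σ)))
          ≤ 1 := by
      intro u' hu' hu'1 k
      have := ih (Function.update u l u') (fun j => ?_) (fun j => ?_) k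
      · convert this using 5 with v _ i
        rw [hD, Finset.prod_insert (by simp), Function.update_self, hb', ← mul_assoc]
        congr 2
        refine Finset.prod_congr rfl fun j hj => ?_
        rw [Function.update_of_ne (by rintro rfl; simp at hj)]
      · by_cases hj : j = l
        · subst hj; simpa using hu'
        · simpa [hj] using hu j
      · by_cases hj : j = l
        · subst hj; simpa using hu'1
        · simpa [hj] using hu1 j
    have hpos : 0 < 1 - σ := by linarith
    have hpos' : 0 < θ l * (1 - σ) - c l := by
      have := mul_pos (hθ l) (sub_pos.2 hlam)
      nlinarith
    -- The estimate along l itself comes first, because removing the same weight along any k ≠ l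
    -- uses it as input. Both removals replace 1 - σ by 1 - σ - c l / θ l.
    have hown := sum_rpow_fiberSum_le_one_of_own (π l) hb'0 (h := θ l * (1 - σ)) (hc l)
      (by linarith) (fun u' h1 h2 => hw u' h1 h2 l)
    intro k
    by_cases hk : k = l
    · subst hk
      convert hown using 5
      rw [← hclθ]
      have := (hθ k).ne'
      field_simp
      ring
    · have := sum_rpow_fiberSum_le_one_of_cross (π k) (π l) hb'0 (mul_pos (hθ k) hpos).le hpos'
        (hc l) hown (fun u' h1 h2 => hw u' h1 h2 k)
      convert this using 5
      have := (hθ l).ne'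
      rw [sub_add_cancel, mul_assoc]
      congr 1
      field_simp
      ring

/-- A mixed norm inequality of Blei type. -/
theorem sum_rpow_le_one_of_fiberSum [Nonempty κ] (π : ∀ k, I → V k)
    (hπ : Function.Injective fun i k => π k i) {b : I → ℝ} (hb : ∀ i, 0 ≤ b i)
    {e : κ → ℝ} (he₀ : ∀ k, 0 < e k) (he₁ : ∀ k, e k < 1)
    (H : ∀ k, ∑ v, fiberSum (π k) b v ^ e k ≤ 1) {R : ℝ} (hR : R = ∑ k, e k / (1 - e k)) :
    ∑ i, b i ^ (R / (1 + R)) ≤ 1 := by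
  have hpos : ∀ k, 0 < e k / (1 - e k) := fun k => div_pos (he₀ k) (sub_pos.2 (he₁ k))
  have hRpos : 0 < R := hR ▸ Finset.sum_pos (fun k _ => hpos k) Finset.univ_nonempty
  set σ := R / (1 + R) with hσ
  have hσ0 : 0 < σ := by positivity
  have hσ1 : 1 - σ = 1 / (1 + R) := by rw [hσ]; field_simp; ring
  have hσ1' : 0 < 1 - σ := by rw [hσ1]; positivity
  set X := fun k => fiberSum (π k) b
  have hX : ∀ k v, 0 ≤ X k v := fun k => fiberSum_nonneg (π k) hb
  set ω := fun k => e k / (1 - e k) / R with hω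
  have hω0 : ∀ k, 0 < ω k := fun k => div_pos (hpos k) hRpos
  have hω1 : ∑ k, ω k = 1 := by
    simp only [hω]
    rw [← Finset.sum_div, ← hR, div_self hRpos.ne']
  -- The weights ω and σ cancel every power of X k: (e k - 1) ω k σ + e k (1 - σ) = 0. So b^σ is a
  -- geometric mean of the terms on the right.
  have hterm : ∀ i, b i ^ σ ≤ σ * ∑ k, ω k * (X k (π k i) ^ (e k - 1) * b i)
      + (1 - σ) * ∏ k, X k (π k i) ^ e k := by
    intro i
    rcases (hb i).eq_or_lt with h0 | h0
    · rw [← h0, Real.zero_rpow hσ0.ne']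
      have : 0 ≤ ∏ k, X k (π k i) ^ e k :=
        Finset.prod_nonneg fun k _ => Real.rpow_nonneg (hX k _) _
      simp only [mul_zero, Finset.sum_const_zero, zero_add]
      positivity
    have hXi : ∀ k, 0 < X k (π k i) := fun k => h0.trans_le (le_fiberSum (π k) hb i)
    have h1 := Real.geom_mean_le_arith_mean_weighted Finset.univ ω
      (fun k => X k (π k i) ^ (e k - 1) * b i) (fun k _ => (hω0 k).le) hω1
      (fun k _ => by have := hXi k; positivity)
    have hprod : 0 ≤ ∏ k, X k (π k i) ^ e k :=
      Finset.prod_nonneg fun k _ => Real.rpow_nonneg (hX k _) _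
    have hprod' : 0 ≤ ∏ k, (X k (π k i) ^ (e k - 1) * b i) ^ ω k :=
      Finset.prod_nonneg fun k _ => by have := hXi k; positivity
    have h2 := Real.geom_mean_le_arith_mean2_weighted hσ0.le hσ1'.le hprod' hprod (by ring)
    refine le_trans (le_of_eq ?_) (h2.trans (by gcongr))
    rw [← Real.finsetProd_rpow _ _ fun k _ => by have := hXi k; positivity,
      ← Real.finsetProd_rpow _ _ fun k _ => by have := hXi k; positivity,
      ← Finset.prod_mul_distrib]
    have : ∀ k, ((X k (π k i) ^ (e k - 1) * b i) ^ ω k) ^ σ * (X k (π k i) ^ e k) ^ (1 - σ)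
        = b i ^ (ω k * σ) := by
      intro k
      have hk := hXi k
      rw [← Real.rpow_mul (by positivity), Real.mul_rpow (by positivity) h0.le,
        ← Real.rpow_mul hk.le, ← Real.rpow_mul hk.le, mul_right_comm, ← Real.rpow_add hk]
      have : (e k - 1) * (ω k * σ) + e k * (1 - σ) = 0 := by
        have := sub_pos.2 (he₁ k)
        rw [hσ1]
        simp only [hω, hσ]
        field_simp
        ring
      rw [this, Real.rpow_zero, one_mul]
    simp only [this]
    rw [← Real.rpow_sum_of_pos h0, ← Finset.sum_mul, hω1, one_mul]
  -- An index is determined by its projections, so the sum is part of the expanded product of the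
  -- sums over the V k.
  have hlast : ∑ i, ∏ k, X k (π k i) ^ e k ≤ 1 := by
    calc ∑ i, ∏ k, X k (π k i) ^ e k
        = ∑ w ∈ Finset.univ.map ⟨_, hπ⟩, ∏ k, X k (w k) ^ e k := by simp
      _ ≤ ∑ w : ∀ k, V k, ∏ k, X k (w k) ^ e k :=
          Finset.sum_le_sum_of_subset_of_nonneg (Finset.subset_univ _) fun w _ _ =>
            Finset.prod_nonneg fun k _ => Real.rpow_nonneg (hX k _) _
      _ = ∏ k, ∑ v, X k v ^ e k := by
          rw [Finset.prod_univ_sum, Fintype.piFinset_univ]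
      _ ≤ 1 := Finset.prod_le_one (fun k _ => Finset.sum_nonneg fun v _ =>
          Real.rpow_nonneg (hX k _) _) fun k _ => H k
  have hfirst : ∀ k, ∑ i, X k (π k i) ^ (e k - 1) * b i ≤ 1 := fun k =>
    (sum_mul_rpow_fiberSum (π k) hb (he₀ k)).trans_le (H k)
  calc ∑ i, b i ^ σ
      ≤ ∑ i, (σ * ∑ k, ω k * (X k (π k i) ^ (e k - 1) * b i)
          + (1 - σ) * ∏ k, X k (π k i) ^ e k) := Finset.sum_le_sum fun i _ => hterm i
    _ = σ * ∑ k, ω k * ∑ i, X k (π k i) ^ (e k - 1) * b i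
          + (1 - σ) * ∑ i, ∏ k, X k (π k i) ^ e k := by
        rw [Finset.sum_add_distrib, ← Finset.mul_sum, ← Finset.mul_sum, Finset.sum_comm]
        simp only [Finset.mul_sum]
    _ ≤ σ * ∑ k, ω k * 1 + (1 - σ) * 1 := by
        gcongr with k
        · exact (hω0 k).le
        · exact hfirst k
    _ = 1 := by simp only [mul_one]; rw [hω1]; ring

end Blocks

/-! ### Kahane's inequality and cotype inside mixed norms. -/

section Kahane

variable {Y : Type*} [NormedAddCommGroup Y]

/-- The signed sum `∑ ± y_i`, with the sign `+` where `ε i` is true. -/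
def signedSum {N : ℕ} (ε : Fin N → Bool) (y : Fin N → Y) : Y :=
  ∑ i, if ε i then y i else -y i

lemma signedSum_cons {N : ℕ} (b : Bool) (ε : Fin N → Bool) (y : Fin (N + 1) → Y) :
    signedSum (Fin.cons b ε : Fin (N + 1) → Bool) y
      = (if b then y 0 else -y 0) + signedSum ε (fun i => y i.succ) := by
  simp [signedSum, Fin.sum_univ_succ]

lemma sum_signs_succ {N : ℕ} (F : (Fin (N + 1) → Bool) → ℝ) :
    ∑ ε, F ε = ∑ ε : Fin N → Bool, (F (Fin.cons true ε) + F (Fin.cons false ε)) := by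
  rw [← (Fin.consEquiv fun _ => Bool).sum_comp, Fintype.sum_prod_type_right]
  simp [Fin.consEquiv]

/-- Minkowski's inequality for sums of vectors of the Euclidean plane. -/
lemma sq_sum_add_sq_sum_le {ι : Type*} (s : Finset ι) {a b c : ι → ℝ} (hc : ∀ i, 0 ≤ c i) (h : ∀ i, a i ^ 2 + b i ^ 2 ≤ c i ^ 2) :
    (∑ i ∈ s, a i) ^ 2 + (∑ i ∈ s, b i) ^ 2 ≤ (∑ i ∈ s, c i) ^ 2 := by
  classical
  induction s using Finset.induction_on with
  | empty => simp
  | insert i s hi ih =>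
    rw [Finset.sum_insert hi, Finset.sum_insert hi, Finset.sum_insert hi]
    have hC : 0 ≤ ∑ i ∈ s, c i := Finset.sum_nonneg fun i _ => hc i
    generalize ∑ i ∈ s, a i = A at *
    generalize ∑ i ∈ s, b i = B at *
    generalize ∑ i ∈ s, c i = C at *
    have h1 : a i * A + b i * B ≤ c i * C := by
      refine abs_le_of_sq_le_sq' ?_ (mul_nonneg (hc i) hC) |>.2
      calc (a i * A + b i * B) ^ 2 ≤ (a i ^ 2 + b i ^ 2) * (A ^ 2 + B ^ 2) := by
            nlinarith [sq_nonneg (a i * B - b i * A)]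
        _ ≤ c i ^ 2 * C ^ 2 := by gcongr; exact h i
        _ = (c i * C) ^ 2 := by ring
    nlinarith [h i]

/-- The two-point hypercontractive inequality, in squared form. -/
lemma two_point_hypercontractive [NormedSpace ℝ Y] {ρ : ℝ} (hρ₀ : 0 ≤ ρ) (hρ : ρ ^ 2 = 1 / 3)
    (w x : Y) :
    (‖w + ρ • x‖ ^ 2) ^ 2 + (‖w - ρ • x‖ ^ 2) ^ 2
      ≤ 2 * ((‖w + x‖ ^ 2 + ‖w - x‖ ^ 2) / 2) ^ 2 := by
  have hρ1 : ρ ≤ 1 := by nlinarith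
  -- Both points are convex combinations of w + x and w - x, which reduces the claim to the scalar
  -- inequality for their norms. There 6ρ² = 2 matches the cross term of the square.
  have e1 : w + ρ • x = ((1 + ρ) / 2) • (w + x) + ((1 - ρ) / 2) • (w - x) := by module
  have e2 : w - ρ • x = ((1 - ρ) / 2) • (w + x) + ((1 + ρ) / 2) • (w - x) := by module
  have n1 : ‖w + ρ • x‖ ≤ (1 + ρ) / 2 * ‖w + x‖ + (1 - ρ) / 2 * ‖w - x‖ := by
    rw [e1]
    refine (norm_add_le _ _).trans (le_of_eq ?_)
    rw [norm_smul, norm_smul, Real.norm_of_nonneg (by linarith), Real.norm_of_nonneg (by linarith)]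
  have n2 : ‖w - ρ • x‖ ≤ (1 - ρ) / 2 * ‖w + x‖ + (1 + ρ) / 2 * ‖w - x‖ := by
    rw [e2]
    refine (norm_add_le _ _).trans (le_of_eq ?_)
    rw [norm_smul, norm_smul, Real.norm_of_nonneg (by linarith), Real.norm_of_nonneg (by linarith)]
  generalize ‖w + x‖ = u at *
  generalize ‖w - x‖ = v at *
  calc (‖w + ρ • x‖ ^ 2) ^ 2 + (‖w - ρ • x‖ ^ 2) ^ 2
      ≤ (((1 + ρ) / 2 * u + (1 - ρ) / 2 * v) ^ 2) ^ 2
        + (((1 - ρ) / 2 * u + (1 + ρ) / 2 * v) ^ 2) ^ 2 := by gcongr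
    _ = 2 * (((u + v) / 2) ^ 4 + 6 * ρ ^ 2 * ((u + v) / 2) ^ 2 * ((u - v) / 2) ^ 2
        + (ρ ^ 2) ^ 2 * ((u - v) / 2) ^ 4) := by ring
    _ ≤ 2 * (((u + v) / 2) ^ 2 + ((u - v) / 2) ^ 2) ^ 2 := by
        rw [hρ]
        nlinarith [sq_nonneg (((u - v) / 2) ^ 2)]
    _ = 2 * ((u ^ 2 + v ^ 2) / 2) ^ 2 := by ring

/-- Tensorization of the two-point inequality. The free vector w absorbs the first summand, so that
the induction hypothesis controls the remaining signs. -/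
lemma signs_hypercontractive [NormedSpace ℝ Y] {ρ : ℝ} (hρ₀ : 0 ≤ ρ) (hρ : ρ ^ 2 = 1 / 3) (N : ℕ) :
    ∀ (w : Y) (y : Fin N → Y), 2 ^ N * ∑ ε, (‖w + ρ • signedSum ε y‖ ^ 2) ^ 2
      ≤ (∑ ε, ‖w + signedSum ε y‖ ^ 2) ^ 2 := by
  induction N with
  | zero => intro w y; simp [signedSum]
  | succ N ih =>
    intro w y
    rw [sum_signs_succ, sum_signs_succ, Finset.sum_add_distrib]
    simp only [signedSum_cons, if_true, Bool.false_eq_true, if_false]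
    set y' : Fin N → Y := fun i => y i.succ
    have h1 := ih (w + ρ • y 0) y'
    have h2 := ih (w - ρ • y 0) y'
    have hM := sq_sum_add_sq_sum_le Finset.univ
      (a := fun ε : Fin N → Bool => ‖(w + signedSum ε y') + ρ • y 0‖ ^ 2)
      (b := fun ε : Fin N → Bool => ‖(w + signedSum ε y') - ρ • y 0‖ ^ 2)
      (c := fun ε : Fin N → Bool => √2 * ((‖(w + signedSum ε y') + y 0‖ ^ 2
        + ‖(w + signedSum ε y') - y 0‖ ^ 2) / 2))
      (fun _ => by positivity)
      (fun ε => by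
        rw [mul_pow, Real.sq_sqrt (by norm_num)]
        exact two_point_hypercontractive hρ₀ hρ _ _)
    rw [← Finset.mul_sum, mul_pow, Real.sq_sqrt (by norm_num), ← Finset.sum_div] at hM
    have a1 : ∀ ε : Fin N → Bool, w + ρ • (y 0 + signedSum ε y')
        = w + ρ • y 0 + ρ • signedSum ε y' := fun ε => by module
    have a2 : ∀ ε : Fin N → Bool, w + ρ • (-y 0 + signedSum ε y')
        = w - ρ • y 0 + ρ • signedSum ε y' := fun ε => by module
    have a3 : ∀ ε : Fin N → Bool, w + ρ • y 0 + signedSum ε y'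
        = w + signedSum ε y' + ρ • y 0 := fun ε => by module
    have a4 : ∀ ε : Fin N → Bool, w - ρ • y 0 + signedSum ε y'
        = w + signedSum ε y' - ρ • y 0 := fun ε => by module
    have a5 : ∀ ε : Fin N → Bool, w + (y 0 + signedSum ε y') = w + signedSum ε y' + y 0 :=
      fun ε => by module
    have a6 : ∀ ε : Fin N → Bool, w + (-y 0 + signedSum ε y') = w + signedSum ε y' - y 0 :=
      fun ε => by module
    simp only [a1, a2, a5, a6]
    simp only [a3] at h1
    simp only [a4] at h2
    rw [pow_succ]
    nlinarith

/-- Kahane's inequality between the first and the second moment. -/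
theorem kahane_two_one [NormedSpace ℝ Y] {N : ℕ} (y : Fin N → Y) :
    (∑ ε, ‖signedSum ε y‖ ^ 2) / 2 ^ N ≤ 9 * ((∑ ε, ‖signedSum ε y‖) / 2 ^ N) ^ 2 := by
  have h4 := signs_hypercontractive (Y := Y) (ρ := √(1 / 3)) (Real.sqrt_nonneg _)
    (Real.sq_sqrt (by norm_num)) N 0 y
  have hρ : ∀ z : Y, (‖√(1 / 3) • z‖ ^ 2) ^ 2 = ‖z‖ ^ 4 / 9 := fun z => by
    rw [norm_smul, mul_pow, Real.norm_of_nonneg (Real.sqrt_nonneg _), Real.sq_sqrt (by norm_num)]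
    ring
  simp only [zero_add, hρ, ← Finset.sum_div] at h4
  -- Two applications of Cauchy–Schwarz interpolate the second moment between the first and the
  -- fourth; the constant 9 is ρ^(-4).
  have h2 := Finset.sum_sq_le_sum_mul_sum_of_sq_le_mul (Finset.univ : Finset (Fin N → Bool))
    (r := fun ε => ‖signedSum ε y‖ ^ 2) (f := fun ε => ‖signedSum ε y‖)
    (g := fun ε => ‖signedSum ε y‖ ^ 3) (fun _ _ => by positivity) (fun _ _ => by positivity)
    (fun _ _ => le_of_eq (by ring))
  have h3 := Finset.sum_sq_le_sum_mul_sum_of_sq_le_mul (Finset.univ : Finset (Fin N → Bool))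
    (r := fun ε => ‖signedSum ε y‖ ^ 3) (f := fun ε => ‖signedSum ε y‖ ^ 2)
    (g := fun ε => ‖signedSum ε y‖ ^ 4) (fun _ _ => by positivity) (fun _ _ => by positivity)
    (fun _ _ => le_of_eq (by ring))
  have p1 : 0 ≤ ∑ ε, ‖signedSum ε y‖ := by positivity
  have p2 : 0 ≤ ∑ ε, ‖signedSum ε y‖ ^ 2 := by positivity
  generalize ∑ ε, ‖signedSum ε y‖ = A at *
  generalize ∑ ε, ‖signedSum ε y‖ ^ 2 = B at *
  generalize ∑ ε, ‖signedSum ε y‖ ^ 3 = C at *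
  generalize ∑ ε, ‖signedSum ε y‖ ^ 4 = D at *
  have hP : (0 : ℝ) < 2 ^ N := by positivity
  generalize (2 : ℝ) ^ N = P at *
  rw [div_pow, mul_div_assoc', div_le_div_iff₀ hP (by positivity)]
  rcases p2.eq_or_lt with h0 | hB
  · rw [← h0]; simp only [zero_mul]; positivity
  have hBB : P * B ≤ 9 * A ^ 2 := by
    refine le_of_mul_le_mul_right ?_ (pow_pos hB 3)
    calc P * B * B ^ 3 = P * (B ^ 2) ^ 2 := by ring
      _ ≤ P * (A * C) ^ 2 := by gcongr
      _ = P * A ^ 2 * C ^ 2 := by ring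
      _ ≤ P * A ^ 2 * (B * D) := by gcongr
      _ = 9 * A ^ 2 * B * (P * (D / 9)) := by ring
      _ ≤ 9 * A ^ 2 * B * B ^ 2 := by gcongr
      _ = 9 * A ^ 2 * B ^ 3 := by ring
  calc B * P ^ 2 = P * B * P := by ring
    _ ≤ 9 * A ^ 2 * P := by gcongr

/-- Cotype `q` expressed with the first moment of the random sums. -/
theorem HasCotype.exists_first_moment [NormedSpace ℝ Y] {q : ℝ} (hq : HasCotype Y q) :
    ∃ K : ℝ, 0 < K ∧ ∀ (N : ℕ) (y : Fin N → Y),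
      (∑ i, ‖y i‖ ^ q) ^ (1 / q) ≤ ∑ ε, K / 2 ^ N * ‖signedSum ε y‖ := by
  obtain ⟨_, K, hK, h⟩ := hq
  refine ⟨3 * K, by positivity, fun N y => (h N y).trans ?_⟩
  have h1 := kahane_two_one y
  rw [← Finset.mul_sum]
  have : √((∑ ε, ‖signedSum ε y‖ ^ 2) / 2 ^ N) ≤ 3 * ((∑ ε, ‖signedSum ε y‖) / 2 ^ N) := by
    refine Real.sqrt_le_iff.2 ⟨by positivity, h1.trans (le_of_eq (by ring))⟩
  calc K * √((∑ ε, ‖signedSum ε y‖ ^ 2) / 2 ^ N)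
      ≤ K * (3 * ((∑ ε, ‖signedSum ε y‖) / 2 ^ N)) := by gcongr
    _ = _ := by ring

/-- Minkowski's inequality for finite sums of elements of `ℓ^q`. -/
lemma Lp_sum_le {α β : Type*} (s : Finset α) (t : Finset β) {q : ℝ} (hq : 1 ≤ q) {f : β → α → ℝ}
    (hf : ∀ b a, 0 ≤ f b a) :
    (∑ a ∈ s, (∑ b ∈ t, f b a) ^ q) ^ (1 / q) ≤ ∑ b ∈ t, (∑ a ∈ s, f b a ^ q) ^ (1 / q) := by
  classical
  induction t using Finset.induction_on with
  | empty =>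
    have : q ≠ 0 := by linarith
    simp [Real.zero_rpow this, Real.zero_rpow (inv_ne_zero this)]
  | insert b t hb ih =>
    simp only [Finset.sum_insert hb]
    refine (Real.Lp_add_le_of_nonneg s hq (fun a _ => hf b a)
      (fun a _ => Finset.sum_nonneg fun b _ => hf b a)).trans ?_
    gcongr

/-- If the index `s` is summed by cotype inside an `ℓ^q`-sum, the result is an average of
`ℓ^q`-sums over the signs. -/
lemma Lq_le_sum_signs {K q : ℝ} {N : ℕ} (hK : 0 < K) (hq : 1 ≤ q)
    (h : ∀ y : Fin N → Y,
      (∑ i, ‖y i‖ ^ q) ^ (1 / q) ≤ ∑ ε, K / 2 ^ N * ‖signedSum ε y‖)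
    {α : Type*} (s : Finset α) (y : α → Fin N → Y) :
    (∑ a ∈ s, ∑ i, ‖y a i‖ ^ q) ^ (1 / q)
      ≤ ∑ ε, K / 2 ^ N * (∑ a ∈ s, ‖signedSum ε (y a)‖ ^ q) ^ (1 / q) := by
  have hq0 : 0 < q := by linarith
  have h1 : ∀ a, ∑ i, ‖y a i‖ ^ q ≤ (∑ ε, K / 2 ^ N * ‖signedSum ε (y a)‖) ^ q := fun a => by
    have := Real.rpow_le_rpow (by positivity) (h (y a)) hq0.le
    rwa [← Real.rpow_mul (by positivity), one_div_mul_cancel hq0.ne', Real.rpow_one] at this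
  refine (Real.rpow_le_rpow (by positivity) (Finset.sum_le_sum fun a _ => h1 a)
    (by positivity)).trans ((Lp_sum_le s _ hq fun _ _ => by positivity).trans (le_of_eq ?_))
  refine Finset.sum_congr rfl fun ε _ => ?_
  have hc : (0 : ℝ) ≤ K / 2 ^ N := by positivity
  simp only [Real.mul_rpow hc (norm_nonneg _)]
  rw [← Finset.mul_sum, Real.mul_rpow (by positivity) (by positivity), ← Real.rpow_mul hc,
    mul_one_div_cancel hq0.ne', Real.rpow_one]

/-- Mixed norm version of `Lq_le_sum_signs`. -/
lemma mixed_le_sum_signs {K q r : ℝ} {N : ℕ} (hK : 0 < K) (hq : 1 ≤ q) (hr : 1 ≤ r)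
    (h : ∀ y : Fin N → Y,
      (∑ i, ‖y i‖ ^ q) ^ (1 / q) ≤ ∑ ε, K / 2 ^ N * ‖signedSum ε y‖)
    {α β : Type*} (S : Finset β) (s : β → Finset α) (y : β → α → Fin N → Y) {M : ℝ}
    (hM : ∀ ε, ∑ v ∈ S, (∑ a ∈ s v, ‖signedSum ε (y v a)‖ ^ q) ^ (r / q) ≤ M ^ r) (hM0 : 0 ≤ M) :
    ∑ v ∈ S, (∑ a ∈ s v, ∑ i, ‖y v a i‖ ^ q) ^ (r / q) ≤ (K * M) ^ r := by
  have hq0 : 0 < q := by linarith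
  have hr0 : 0 < r := by linarith
  have e1 : ∀ x : ℝ, 0 ≤ x → x ^ (r / q) = (x ^ (1 / q)) ^ r := fun x hx => by
    rw [← Real.rpow_mul hx]; congr 1; ring
  have h1 : (∑ v ∈ S, ((∑ a ∈ s v, ∑ i, ‖y v a i‖ ^ q) ^ (1 / q)) ^ r) ^ (1 / r) ≤ K * M := by
    refine (Real.rpow_le_rpow (by positivity) (Finset.sum_le_sum fun v _ => Real.rpow_le_rpow
      (by positivity) (Lq_le_sum_signs hK hq h (s v) (y v)) hr0.le) (by positivity)).trans ?_
    -- Minkowski was used in ℓ^q inside and is used in ℓ^r here, so r and q need not be compared.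
    -- Only a first moment, being linear, passes through both norms.
    refine (Lp_sum_le S _ hr fun _ _ => by positivity).trans ?_
    have hc : (0 : ℝ) ≤ K / 2 ^ N := by positivity
    calc _ ≤ ∑ ε : Fin N → Bool, K / 2 ^ N * M := by
          refine Finset.sum_le_sum fun ε _ => ?_
          simp only [Real.mul_rpow hc (Real.rpow_nonneg (Finset.sum_nonneg fun a _ =>
            Real.rpow_nonneg (norm_nonneg _) _) _)]
          rw [← Finset.mul_sum, Real.mul_rpow (by positivity) (by positivity), ← Real.rpow_mul hc,
            mul_one_div_cancel hr0.ne', Real.rpow_one]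
          gcongr
          have := Real.rpow_le_rpow (by positivity) (hM ε) (one_div_pos.2 hr0).le
          rw [← Real.rpow_mul hM0, mul_one_div_cancel hr0.ne', Real.rpow_one] at this
          refine le_trans (le_of_eq ?_) this
          congr 1
          exact Finset.sum_congr rfl fun v _ => (e1 _ (by positivity)).symm
      _ = K * M := by
          simp
          field_simp
  have := Real.rpow_le_rpow (by positivity) h1 hr0.le
  rw [← Real.rpow_mul (by positivity), one_div_mul_cancel hr0.ne', Real.rpow_one] at this
  refine le_trans (le_of_eq ?_) this
  exact Finset.sum_congr rfl fun v _ => e1 _ (by positivity)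

end Kahane

/-! ### Weakly summable sequences and their weighted signed sums. -/

section WeakNorm

variable {𝕜 : Type*} [RCLike 𝕜] {E : Type*} [NormedAddCommGroup E] [NormedSpace 𝕜 E]

lemma weakNorm_single_le {p : ℝ} (hp : 0 < p) (y : E) :
    weakNorm 𝕜 p (fun n : ℕ => if n = 0 then y else 0) ≤ ‖y‖ₑ := by
  refine iSup₂_le fun φ hφ => ?_
  rw [tsum_eq_single 0 (fun n hn => by simp [hn, hp])]
  rw [← ENNReal.rpow_mul, mul_one_div_cancel hp.ne', ENNReal.rpow_one]
  simp only [if_true]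
  refine (φ.le_opENorm y).trans ?_
  have : ‖φ‖ₑ ≤ 1 := by
    rw [← ofReal_norm]
    exact ENNReal.ofReal_le_one.2 hφ
  calc ‖φ‖ₑ * ‖y‖ₑ ≤ 1 * ‖y‖ₑ := by gcongr
    _ = ‖y‖ₑ := one_mul _

lemma sum_enorm_rpow_le_of_weakNorm_le {p : ℝ} (hp : 0 < p) {x : ℕ → E} {a : ℝ≥0∞}
    (hx : weakNorm 𝕜 p x ≤ a) {φ : E →L[𝕜] 𝕜} (hφ : ‖φ‖ ≤ 1) :
    ∑' i, ‖φ (x i)‖ₑ ^ p ≤ a ^ p := by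
  have h : (∑' i, ‖φ (x i)‖ₑ ^ p) ^ (1 / p) ≤ a :=
    (le_iSup₂ (f := fun (φ : E →L[𝕜] 𝕜) (_ : ‖φ‖ ≤ 1) => (∑' i, ‖φ (x i)‖ₑ ^ p) ^ (1 / p))
      φ hφ).trans hx
  have := ENNReal.rpow_le_rpow h hp.le
  rwa [← ENNReal.rpow_mul, one_div_mul_cancel hp.ne', ENNReal.rpow_one] at this

lemma sum_norm_rpow_le_one_of_weakNorm_le_one {p : ℝ} (hp : 0 < p) {x : ℕ → E}
    (hx : weakNorm 𝕜 p x ≤ 1) {φ : E →L[𝕜] 𝕜} (hφ : ‖φ‖ ≤ 1) (N : ℕ) :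
    ∑ s : Fin N, ‖φ (x s)‖ ^ p ≤ 1 := by
  have h := sum_enorm_rpow_le_of_weakNorm_le hp hx hφ
  rw [ENNReal.one_rpow] at h
  have h1 : ∑ s : Fin N, ‖φ (x s)‖ₑ ^ p ≤ 1 := by
    rw [Fin.sum_univ_eq_sum_range (fun s => ‖φ (x s)‖ₑ ^ p)]
    exact (ENNReal.sum_le_tsum _).trans h
  rw [← ENNReal.ofReal_le_one, ENNReal.ofReal_sum_of_nonneg fun _ _ => by positivity]
  refine le_trans (le_of_eq (Finset.sum_congr rfl fun s _ => ?_)) h1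
  rw [← ENNReal.ofReal_rpow_of_nonneg (norm_nonneg _) hp.le, ofReal_norm]

lemma invConj_nonneg {p : ℝ} (hp : 1 ≤ p) : 0 ≤ invConj p := by
  rw [invConj, sub_nonneg, div_le_one (by linarith)]
  exact hp

/-- Hölder's inequality between `ℓ^{p^*}` weights and weakly `p`-summable sequences. -/
lemma norm_signedSum_le_one {p : ℝ} (hp : 1 ≤ p) {x : ℕ → E} (hx : weakNorm 𝕜 p x ≤ 1) {N : ℕ}
    {u : ℕ → ℝ} (hu : ∀ n, 0 ≤ u n) (hu1 : ∑ s : Fin N, u s ≤ 1) (ε : Fin N → Bool) :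
    ‖signedSum ε (fun s => (((u s) ^ invConj p : ℝ) : 𝕜) • x s)‖ ≤ 1 := by
  have hp0 : 0 < p := by linarith
  have hcj := invConj_nonneg hp
  obtain ⟨g, hg, hgS⟩ := exists_dual_vector'' 𝕜 (signedSum ε (fun s => (((u s) ^ invConj p : ℝ) : 𝕜) • x s))
  have hsum := sum_norm_rpow_le_one_of_weakNorm_le_one hp0 hx hg N
  calc ‖signedSum ε (fun s => (((u s) ^ invConj p : ℝ) : 𝕜) • x s)‖
      = ‖g (signedSum ε (fun s => (((u s) ^ invConj p : ℝ) : 𝕜) • x s))‖ := by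
        rw [hgS, RCLike.norm_ofReal, abs_norm]
    _ ≤ ∑ s : Fin N, u s ^ invConj p * ‖g (x s)‖ := by
        rw [signedSum, map_sum]
        refine (norm_sum_le _ _).trans (Finset.sum_le_sum fun s _ => le_of_eq ?_)
        rw [apply_ite g, map_neg, apply_ite norm, norm_neg, ite_self, map_smul, norm_smul,
          RCLike.norm_ofReal, abs_of_nonneg (Real.rpow_nonneg (hu s) _)]
    _ ≤ ∑ s : Fin N, (invConj p * u s + 1 / p * ‖g (x s)‖ ^ p) := by
        -- Young's inequality with weights 1/p^* and 1/p; the weight 0 is allowed, which covers p =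
        -- 1.
        refine Finset.sum_le_sum fun s _ => ?_
        have := Real.geom_mean_le_arith_mean2_weighted hcj (one_div_pos.2 hp0).le (hu s)
          (Real.rpow_nonneg (norm_nonneg (g (x s))) p) (by rw [invConj]; ring)
        rwa [← Real.rpow_mul (norm_nonneg _), mul_one_div_cancel hp0.ne', Real.rpow_one] at this
    _ = invConj p * ∑ s : Fin N, u s + 1 / p * ∑ s : Fin N, ‖g (x s)‖ ^ p := by
        rw [Finset.sum_add_distrib, Finset.mul_sum, Finset.mul_sum]
    _ ≤ invConj p * 1 + 1 / p * 1 := by gcongr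
    _ = 1 := by rw [invConj]; ring

lemma weakNorm_smul_le {p : ℝ} (hp : 0 < p) (a : 𝕜) (x : ℕ → E) :
    weakNorm 𝕜 p (fun n => a • x n) ≤ ‖a‖ₑ * weakNorm 𝕜 p x := by
  refine iSup₂_le fun φ hφ => ?_
  have h := sum_enorm_rpow_le_of_weakNorm_le hp (le_refl (weakNorm 𝕜 p x)) hφ
  simp only [map_smul, enorm_smul, ENNReal.mul_rpow_of_nonneg _ _ hp.le, ENNReal.tsum_mul_left]
  rw [ENNReal.mul_rpow_of_nonneg _ _ (one_div_pos.2 hp).le, ← ENNReal.rpow_mul,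
    mul_one_div_cancel hp.ne', ENNReal.rpow_one]
  gcongr
  have := ENNReal.rpow_le_rpow h (one_div_pos.2 hp).le
  rwa [← ENNReal.rpow_mul, mul_one_div_cancel hp.ne', ENNReal.rpow_one] at this

lemma eq_zero_of_weakNorm_eq_zero {p : ℝ} (hp : 0 < p) {x : ℕ → E} (hx : weakNorm 𝕜 p x = 0)
    (n : ℕ) : x n = 0 := by
  obtain ⟨g, hg, hgx⟩ := exists_dual_vector'' 𝕜 (x n)
  have h := sum_enorm_rpow_le_of_weakNorm_le hp hx.le hg
  rw [ENNReal.zero_rpow_of_pos hp, nonpos_iff_eq_zero, ENNReal.tsum_eq_zero] at h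
  have := h n
  rw [ENNReal.rpow_eq_zero_iff_of_pos hp, enorm_eq_zero, hgx] at this
  simpa using this

end WeakNorm

/-! ### Constants independent of the frozen coordinates. -/

section UniformBound

variable {𝕜 : Type*} [RCLike 𝕜] {ι : Type*} [Fintype ι] [DecidableEq ι]
  {X : ι → Type*} [∀ j, NormedAddCommGroup (X j)] [∀ j, NormedSpace 𝕜 (X j)]
  {Y : Type*} [NormedAddCommGroup Y] [NormedSpace 𝕜 Y]

/-- The uniform boundedness principle for `ℓ^r`-sums of continuous linear maps. -/
lemma exists_uniform_bound {E : Type*} [NormedAddCommGroup E] [NormedSpace 𝕜 E] [CompleteSpace E]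
    {A : Type*} (J : A → Type*) [∀ a, Fintype (J a)] (L : ∀ a, J a → E →ₗ[𝕜] Y)
    (hL : ∀ a i, Continuous (L a i)) {r : ℝ} (hr : 1 ≤ r)
    (h : ∀ w, ∃ M : ℝ, ∀ a, ∑ i, ‖L a i w‖ ^ r ≤ M) :
    ∃ M : ℝ, ∀ a w, ‖w‖ ≤ 1 → ∑ i, ‖L a i w‖ ^ r ≤ M := by
  have hr0 : 0 < r := by linarith
  -- Finite index sets make each seminorm continuous; on a Banach space a pointwise bounded supremum
  -- of continuous seminorms is continuous.
  let P : A → Seminorm 𝕜 E := fun a => Seminorm.of (fun w => (∑ i, ‖L a i w‖ ^ r) ^ (1 / r))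
    (fun v w => by
      refine le_trans ?_ (Real.Lp_add_le_of_nonneg Finset.univ hr (fun i _ => norm_nonneg (L a i v))
        (fun i _ => norm_nonneg (L a i w)))
      gcongr with i
      rw [map_add]
      exact norm_add_le _ _)
    (fun c w => by
      simp only [map_smul, norm_smul]
      simp_rw [Real.mul_rpow (norm_nonneg c) (norm_nonneg _)]
      rw [← Finset.mul_sum, Real.mul_rpow (by positivity) (by positivity),
        ← Real.rpow_mul (norm_nonneg _), mul_one_div_cancel hr0.ne', Real.rpow_one])
  have hP : ∀ a w, P a w = (∑ i, ‖L a i w‖ ^ r) ^ (1 / r) := fun _ _ => rfl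
  have hPc : ∀ a, Continuous (P a) := fun a => by
    change Continuous fun w => (∑ i, ‖L a i w‖ ^ r) ^ (1 / r)
    refine Continuous.rpow_const ?_ fun _ => Or.inr (one_div_pos.2 hr0).le
    exact continuous_finsetSum _ fun i _ =>
      ((hL a i).norm).rpow_const fun _ => Or.inr hr0.le
  have hbdd : BddAbove (Set.range P) := by
    rw [Seminorm.bddAbove_range_iff]
    intro w
    obtain ⟨M, hM⟩ := h w
    refine ⟨M ^ (1 / r), ?_⟩
    rintro _ ⟨a, rfl⟩
    exact Real.rpow_le_rpow (by positivity) (hM a) (one_div_pos.2 hr0).le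
  have hsup : Continuous (⨆ a, P a : Seminorm 𝕜 E) := by
    rw [Seminorm.coe_iSup_eq hbdd]
    exact Seminorm.continuous_iSup P hPc hbdd
  obtain ⟨C, hC0, hC⟩ := Seminorm.bound_of_continuous_normedSpace _ hsup
  refine ⟨C ^ r, fun a w hw => ?_⟩
  have h1 : P a w ≤ C := by
    calc P a w ≤ (⨆ a, P a : Seminorm 𝕜 E) w := le_ciSup hbdd a w
      _ ≤ C * ‖w‖ := hC w
      _ ≤ C := by nlinarith
  rw [hP] at h1
  have := Real.rpow_le_rpow (by positivity) h1 hr0.le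
  rwa [← Real.rpow_mul (by positivity), one_div_mul_cancel hr0.ne', Real.rpow_one] at this

omit [DecidableEq ι] in
/-- A multiple summing map is bounded. -/
lemma IsMultipleSumming.exists_norm_le {T : MultilinearMap 𝕜 X Y} {r : ℝ} {p : ι → ℝ}
    (hr : 0 < r) (hp : ∀ j, 0 < p j) (h : IsMultipleSumming r p T) :
    ∃ K : ℝ, 0 < K ∧ ∀ y, ‖T y‖ ≤ K * ∏ j, ‖y j‖ := by
  obtain ⟨K, hK, h⟩ := h
  refine ⟨K, hK, fun y => ?_⟩
  have h1 := h fun j n => if n = 0 then y j else 0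
  have h2 : ‖T y‖ₑ ≤ ENNReal.ofReal K * ∏ j, ‖y j‖ₑ := by
    calc ‖T y‖ₑ = (‖T y‖ₑ ^ r) ^ (1 / r) := by
          rw [← ENNReal.rpow_mul, mul_one_div_cancel hr.ne', ENNReal.rpow_one]
      _ ≤ _ := by
          refine ENNReal.rpow_le_rpow ?_ (one_div_pos.2 hr).le
          refine le_trans (le_of_eq ?_) (ENNReal.le_tsum (fun _ => 0 : ι → ℕ))
          simp
      _ ≤ _ := h1
      _ ≤ _ := by
          gcongr with j
          exact weakNorm_single_le (hp j) (y j)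
  have h3 : ENNReal.ofReal ‖T y‖ ≤ ENNReal.ofReal (K * ∏ j, ‖y j‖) := by
    rw [ENNReal.ofReal_mul hK.le, ENNReal.ofReal_prod_of_nonneg fun _ _ => norm_nonneg _]
    simpa only [ofReal_norm] using h2
  exact (ENNReal.ofReal_le_ofReal_iff (by positivity)).1 h3

/-- A summing map is bounded, as sequences with one non-zero term show, so T is bounded in each
single variable of C. As the blocks cover all coordinates, this supplies the separate continuity
that Banach–Steinhaus needs. -/
lemma IsCoordinatewiseSumming.continuous_update {T : MultilinearMap 𝕜 X Y} {C : Finset ι}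
    {r p : ℝ} (hr : 0 < r) (hp : 0 < p) (h : IsCoordinatewiseSumming C r p T) {j : ι}
    (hj : j ∈ C) (y : ∀ j, X j) : Continuous (T.toLinearMap y j) := by
  obtain ⟨K, hK, hb⟩ := (h fun l => y l).exists_norm_le hr fun _ => hp
  refine (LinearMap.mkContinuous (T.toLinearMap y j)
    (K * ∏ l ∈ Finset.univ.erase (⟨j, hj⟩ : {a // a ∈ C}), ‖y l‖) fun w => ?_).continuous
  have h1 := hb fun l => Function.update y j w l
  rw [← Finset.mul_prod_erase _ _ (Finset.mem_univ (⟨j, hj⟩ : {a // a ∈ C}))] at h1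
  have h2 : ∏ l ∈ Finset.univ.erase (⟨j, hj⟩ : {a // a ∈ C}), ‖Function.update y j w l‖
      = ∏ l ∈ Finset.univ.erase (⟨j, hj⟩ : {a // a ∈ C}), ‖y l‖ := by
    refine Finset.prod_congr rfl fun l hl => ?_
    rw [Function.update_of_ne]
    rintro h
    exact (Finset.mem_erase.1 hl).1 (Subtype.ext h)
  rw [h2, Function.update_self] at h1
  have h3 : T.toLinearMap y j w = T.domDomRestrict (fun a => a ∈ C) (fun l => y l)
      fun l => Function.update y j w l := by
    rw [MultilinearMap.toLinearMap_apply, MultilinearMap.domDomRestrict_apply]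
    congr 1
    ext l
    split_ifs with hl
    · rfl
    · rw [Function.update_of_ne]
      rintro rfl
      exact hl hj
  rw [h3]
  refine h1.trans (le_of_eq (by ring))

/-- The argument with coordinates `x j (i j)` for `j ∈ C` and `z j` for `j ∉ C`. -/
def blockArg (C : Finset ι) (x : ∀ j, ℕ → X j) {N : ℕ} (i : {a // a ∈ C} → Fin N)
    (z : ∀ j, X j) : ∀ j, X j :=
  fun j => if h : j ∈ C then x j (i ⟨j, h⟩) else z j

omit [Fintype ι] [∀ j, NormedAddCommGroup (X j)] [∀ j, NormedSpace 𝕜 (X j)] in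
lemma blockArg_update {C : Finset ι} {j : ι} (hj : j ∉ C) (x : ∀ j, ℕ → X j) {N : ℕ}
    (i : {a // a ∈ C} → Fin N) (z : ∀ j, X j) (w : X j) :
    blockArg C x i (Function.update z j w) = Function.update (blockArg C x i z) j w := by
  ext l
  by_cases h : l = j
  · subst h; simp [blockArg, hj]
  · simp [blockArg, h]

/-- The constant still depends on z, but not on the box or on the normalized sequences. This is the
pointwise bound that starts the uniform boundedness argument. -/
lemma IsCoordinatewiseSumming.exists_bound {T : MultilinearMap 𝕜 X Y} {C : Finset ι}
    {r p : ℝ} (hr : 0 < r) (h : IsCoordinatewiseSumming C r p T) (z : ∀ j, X j) :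
    ∃ M : ℝ, ∀ (N : ℕ) (x : ∀ j, ℕ → X j), (∀ j ∈ C, weakNorm 𝕜 p (x j) ≤ 1) →
      ∑ i : {a // a ∈ C} → Fin N, ‖T (blockArg C x i z)‖ ^ r ≤ M := by
  obtain ⟨K, hK, h⟩ := h fun l => z l
  refine ⟨K ^ r, fun N x hx => ?_⟩
  have h1 := (h fun j => x j).trans (mul_le_of_le_one_right (zero_le) <|
    Finset.prod_le_one' fun j _ => hx j j.2)
  have h2 := ENNReal.rpow_le_rpow h1 hr.le
  rw [← ENNReal.rpow_mul, one_div_mul_cancel hr.ne', ENNReal.rpow_one,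
    ENNReal.ofReal_rpow_of_nonneg hK.le hr.le] at h2
  rw [← ENNReal.ofReal_le_ofReal_iff (by positivity),
    ENNReal.ofReal_sum_of_nonneg fun _ _ => by positivity]
  refine le_trans ?_ h2
  let f : ({a // a ∈ C} → Fin N) ↪ ({a // a ∈ C} → ℕ) :=
    ⟨fun i j => i j, fun i i' hi => funext fun j => Fin.ext (congrFun hi j)⟩
  refine le_trans (le_of_eq ?_) (ENNReal.sum_le_tsum (Finset.univ.map f))
  rw [Finset.sum_map]
  refine Finset.sum_congr rfl fun i _ => ?_
  rw [← ENNReal.ofReal_rpow_of_nonneg (norm_nonneg _) hr.le, ofReal_norm]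
  rfl

/-- Coordinatewise summability holds with a constant which is uniform for the frozen
coordinates in the unit balls. -/
theorem IsCoordinatewiseSumming.exists_uniform_bound [∀ j, CompleteSpace (X j)]
    {T : MultilinearMap 𝕜 X Y} (hT : ∀ y j, Continuous (T.toLinearMap y j)) {C : Finset ι}
    {r p : ℝ} (hr : 1 ≤ r) (h : IsCoordinatewiseSumming C r p T) :
    ∃ M : ℝ, 0 < M ∧ ∀ (N : ℕ) (x : ∀ j, ℕ → X j) (z : ∀ j, X j),
      (∀ j ∈ C, weakNorm 𝕜 p (x j) ≤ 1) → (∀ j ∉ C, ‖z j‖ ≤ 1) →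
      ∑ i : {a // a ∈ C} → Fin N, ‖T (blockArg C x i z)‖ ^ r ≤ M ^ r := by
  have hr0 : 0 < r := by linarith
  -- D is the set of coordinates over whose unit balls the bound is already uniform; one coordinate
  -- is added at a time.
  suffices H : ∀ D : Finset ι, (∀ j ∈ D, j ∉ C) → ∀ z : ∀ j, X j, ∃ M : ℝ, ∀ (N : ℕ)
      (x : ∀ j, ℕ → X j) (z' : ∀ j, X j), (∀ j ∈ C, weakNorm 𝕜 p (x j) ≤ 1) →
      (∀ j ∉ D, z' j = z j) → (∀ j ∈ D, ‖z' j‖ ≤ 1) →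
      ∑ i : {a // a ∈ C} → Fin N, ‖T (blockArg C x i z')‖ ^ r ≤ M by
    obtain ⟨M, hM⟩ := H Cᶜ (by simp) 0
    refine ⟨(max M 1) ^ (1 / r), by positivity, fun N x z hx hz => ?_⟩
    rw [← Real.rpow_mul (by positivity), one_div_mul_cancel hr0.ne', Real.rpow_one]
    refine le_trans ?_ (le_max_left _ _)
    refine le_trans (le_of_eq ?_) (hM N x (fun j => if j ∈ C then 0 else z j) hx ?_ ?_)
    · refine Finset.sum_congr rfl fun i _ => ?_
      congr 3
      ext j
      by_cases hj : j ∈ C <;> simp [blockArg, hj]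
    · intro j hj
      simp only [Finset.mem_compl, not_not] at hj
      simp [hj]
    · intro j hj
      simp only [Finset.mem_compl] at hj
      simp [hj, hz]
  intro D
  induction D using Finset.induction_on with
  | empty =>
    intro _ z
    obtain ⟨M, hM⟩ := h.exists_bound hr0 z
    refine ⟨M, fun N x z' hx hz _ => ?_⟩
    rw [funext fun j => hz j (by simp)]
    exact hM N x hx
  | insert j D hj ih =>
    intro hD z
    have hjC := hD j (by simp)
    -- The family is indexed by all data except the variable j: nothing is required of a.2.2 at j,
    -- since that entry is overwritten by w.
    let A := {a : ℕ × (∀ j, ℕ → X j) × (∀ j, X j) // (∀ l ∈ C, weakNorm 𝕜 p (a.2.1 l) ≤ 1) ∧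
      (∀ l ∉ insert j D, a.2.2 l = z l) ∧ (∀ l ∈ D, ‖a.2.2 l‖ ≤ 1)}
    obtain ⟨M, hM⟩ := _root_.exists_uniform_bound (𝕜 := 𝕜) (A := A)
      (fun a => {b // b ∈ C} → Fin a.1.1)
      (fun a i => T.toLinearMap (blockArg C a.1.2.1 i a.1.2.2) j) (fun a i => hT _ _) hr
      (fun w => by
        obtain ⟨M, hM⟩ := ih (fun l hl => hD l (Finset.mem_insert_of_mem hl))
          (Function.update z j w)
        refine ⟨M, fun ⟨⟨N, x, z'⟩, hx, hz, hz'⟩ => ?_⟩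
        refine le_trans (le_of_eq ?_) (hM N x (Function.update z' j w) hx ?_ ?_)
        · simp only [MultilinearMap.toLinearMap_apply, blockArg_update hjC]
        · intro l hl
          by_cases hlj : l = j
          · subst hlj; simp
          · simp only [ne_eq, hlj, not_false_eq_true, Function.update_of_ne]
            exact hz l (by simp [hlj, hl])
        · intro l hl
          have hlj : l ≠ j := by rintro rfl; exact hj hl
          simpa [hlj] using hz' l hl)
    refine ⟨M, fun N x z' hx hz hz' => ?_⟩
    refine le_trans (le_of_eq ?_) (hM ⟨⟨N, x, z'⟩, hx, hz,
      fun l hl => hz' l (Finset.mem_insert_of_mem hl)⟩ (z' j) (hz' j (by simp)))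
    simp only [MultilinearMap.toLinearMap_apply, ← blockArg_update hjC, Function.update_eq_self]

end UniformBound

/-! ### The mixed (r, q) estimate. -/

section CotypeEstimate

variable {𝕜 : Type*} [RCLike 𝕜] {ι : Type*} [Fintype ι] [DecidableEq ι]
  {X : ι → Type*} [∀ j, NormedAddCommGroup (X j)] [∀ j, NormedSpace 𝕜 (X j)]
  {Y : Type*} [NormedAddCommGroup Y] [NormedSpace 𝕜 Y]

lemma map_signedSum {E F : Type*} [NormedAddCommGroup E] [NormedSpace 𝕜 E]
    [NormedAddCommGroup F] [NormedSpace 𝕜 F] (L : E →ₗ[𝕜] F) {N : ℕ} (ε : Fin N → Bool)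
    (y : Fin N → E) : L (signedSum ε y) = signedSum ε (fun s => L (y s)) := by
  simp only [signedSum, map_sum, apply_ite L, map_neg]

/-- Multi-indices which agree with `v` on `C`, are free on `D` and vanish elsewhere. -/
def boxOver (C D : Finset ι) {N : ℕ} (v : {a // a ∈ C} → Fin (N + 1)) :
    Finset (ι → Fin (N + 1)) :=
  Fintype.piFinset fun j => if h : j ∈ C then {v ⟨j, h⟩} else if j ∈ D then Finset.univ else {0}

lemma mem_boxOver {C D : Finset ι} {N : ℕ} {v : {a // a ∈ C} → Fin (N + 1)}
    {i : ι → Fin (N + 1)} :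
    i ∈ boxOver C D v ↔ (∀ j (h : j ∈ C), i j = v ⟨j, h⟩) ∧ ∀ j, j ∉ C → j ∉ D → i j = 0 := by
  rw [boxOver, Fintype.mem_piFinset, ← forall_and]
  refine forall_congr' fun j => ?_
  by_cases h : j ∈ C
  · simp [h]
  · by_cases h' : j ∈ D <;> simp [h, h']

lemma sum_boxOver_insert {C D : Finset ι} {l : ι} (hC : l ∉ C) (hD : l ∉ D) {N : ℕ}
    (v : {a // a ∈ C} → Fin (N + 1)) (F : (ι → Fin (N + 1)) → ℝ) :
    ∑ i ∈ boxOver C (insert l D) v, F i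
      = ∑ i ∈ boxOver C D v, ∑ s, F (Function.update i l s) := by
  rw [← Finset.sum_product']
  refine Finset.sum_nbij' (fun i => (Function.update i l 0, i l))
    (fun a => Function.update a.1 l a.2) ?_ ?_ ?_ ?_ ?_
  · intro i hi
    rw [mem_boxOver] at hi
    simp only [Finset.mem_product, Finset.mem_univ, and_true, mem_boxOver]
    refine ⟨fun j hj => ?_, fun j hj hj' => ?_⟩
    · rw [Function.update_of_ne (by rintro rfl; exact hC hj)]
      exact hi.1 j hj
    · by_cases hjl : j = l
      · subst hjl; simp
      · rw [Function.update_of_ne hjl]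
        exact hi.2 j hj (by simp [hjl, hj'])
  · rintro ⟨i, s⟩ hi
    simp only [Finset.mem_product, Finset.mem_univ, and_true, mem_boxOver] at hi
    rw [mem_boxOver]
    refine ⟨fun j hj => ?_, fun j hj hj' => ?_⟩
    · rw [Function.update_of_ne (by rintro rfl; exact hC hj)]
      exact hi.1 j hj
    · rw [Finset.mem_insert, not_or] at hj'
      rw [Function.update_of_ne hj'.1]
      exact hi.2 j hj hj'.2
  · intro i _
    simp
  · rintro ⟨i, s⟩ hi
    simp only [Finset.mem_product, Finset.mem_univ, and_true, mem_boxOver] at hi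
    have h0 := hi.2 l hC hD
    simp only [Function.update_idem, Function.update_self, Prod.mk.injEq, and_true]
    rw [← h0, Function.update_eq_self]
  · intro i _
    simp

/-- The argument with coordinates `x j (i j)` for `j ∈ C ∪ D` and `z j` elsewhere. -/
def mixedArg (C D : Finset ι) (x : ∀ j, ℕ → X j) {N : ℕ} (i : ι → Fin N) (z : ∀ j, X j) :
    ∀ j, X j :=
  fun j => if j ∈ C ∨ j ∈ D then x j (i j) else z j

/-- Cotype and coordinatewise summability give a mixed `(r, q)`-norm estimate. -/
theorem sum_boxOver_le {T : MultilinearMap 𝕜 X Y} {C : Finset ι} {q r p K M : ℝ} (hq : 1 ≤ q)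
    (hr : 1 ≤ r) (hK : 0 < K) (hM : 0 < M)
    (hcot : ∀ (N : ℕ) (y : Fin N → Y),
      (∑ i, ‖y i‖ ^ q) ^ (1 / q) ≤ ∑ ε, K / 2 ^ N * ‖signedSum ε y‖)
    (hT : ∀ (N : ℕ) (x : ∀ j, ℕ → X j) (z : ∀ j, X j),
      (∀ j ∈ C, weakNorm 𝕜 p (x j) ≤ 1) → (∀ j ∉ C, ‖z j‖ ≤ 1) →
      ∑ i : {a // a ∈ C} → Fin N, ‖T (blockArg C x i z)‖ ^ r ≤ M ^ r)
    (N : ℕ) (x : ∀ j, ℕ → X j) (hx : ∀ j ∈ C, weakNorm 𝕜 p (x j) ≤ 1) (D : Finset ι) :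
    (∀ j ∈ D, j ∉ C) →
    (∀ j ∈ D, ∀ ε : Fin (N + 1) → Bool, ‖signedSum ε (fun s => x j s)‖ ≤ 1) →
    ∀ z : ∀ j, X j, (∀ j ∉ C, ‖z j‖ ≤ 1) →
    ∑ v : {a // a ∈ C} → Fin (N + 1),
      (∑ i ∈ boxOver C D v, ‖T (mixedArg C D x i z)‖ ^ q) ^ (r / q) ≤ (K ^ D.card * M) ^ r := by
  have hq0 : 0 < q := by linarith
  induction D using Finset.induction_on with
  | empty =>
    intro _ _ z hz
    rw [Finset.card_empty, pow_zero, one_mul]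
    refine le_trans (le_of_eq ?_) (hT (N + 1) x z hx hz)
    refine Finset.sum_congr rfl fun v _ => ?_
    have hbox : boxOver C ∅ v = {fun j => if h : j ∈ C then v ⟨j, h⟩ else 0} := by
      ext i
      rw [mem_boxOver, Finset.mem_singleton, funext_iff, ← forall_and]
      refine forall_congr' fun j => ?_
      by_cases h : j ∈ C <;> simp [h]
    rw [hbox, Finset.sum_singleton, ← Real.rpow_mul (norm_nonneg _), mul_div_cancel₀ _ hq0.ne']
    congr 3
    ext j
    by_cases h : j ∈ C <;> simp [mixedArg, blockArg, h]
  | insert l D hl ih =>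
    intro hD hs z hz
    have hlC := hD l (by simp)
    have hupd : ∀ (i : ι → Fin (N + 1)) (s : Fin (N + 1)),
        mixedArg C (insert l D) x (Function.update i l s) z
          = Function.update (mixedArg C D x i z) l (x l s) := by
      intro i s
      ext j
      by_cases h : j = l
      · subst h; simp [mixedArg]
      · simp [mixedArg, h]
    have hupd' : ∀ (i : ι → Fin (N + 1)) (w : X l),
        Function.update (mixedArg C D x i z) l w = mixedArg C D x i (Function.update z l w) := by
      intro i w
      ext j
      by_cases h : j = l
      · subst h; simp [mixedArg, hl, hlC]
      · simp [mixedArg, h]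
    simp only [sum_boxOver_insert hlC hl, hupd]
    rw [Finset.card_insert_of_notMem hl, pow_succ', mul_assoc]
    let _ : NormedSpace ℝ Y := NormedSpace.restrictScalars ℝ 𝕜 Y
    refine mixed_le_sum_signs hK hq hr (hcot (N + 1)) Finset.univ (fun v => boxOver C D v)
      (fun v i s => T (Function.update (mixedArg C D x i z) l (x l s))) (fun ε => ?_)
      (by positivity)
    -- Linearity in the variable l turns the signed sum of values into one value of T at a frozen
    -- vector of norm at most 1. This is why the induction runs over all z.
    have hlin : ∀ i : ι → Fin (N + 1),
        signedSum ε (fun s : Fin (N + 1) => T (Function.update (mixedArg C D x i z) l (x l s)))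
          = T (mixedArg C D x i (Function.update z l (signedSum ε fun s => x l s))) := by
      intro i
      rw [← hupd']
      exact (map_signedSum (T.toLinearMap (mixedArg C D x i z) l) ε fun s => x l s).symm
    simp only [hlin]
    refine ih (fun j hj => hD j (Finset.mem_insert_of_mem hj))
      (fun j hj => hs j (Finset.mem_insert_of_mem hj)) _ fun j hj => ?_
    by_cases h : j = l
    · subst h
      simpa using hs j (by simp) ε
    · simpa [h] using hz j hj

/-- The restriction of multi-indices to the coordinates in `C`. -/
def restrictTo (C : Finset ι) {α : Type*} (i : ι → α) : {a // a ∈ C} → α := fun j => i j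

theorem sum_fiberSum_restrictTo_le {T : MultilinearMap 𝕜 X Y} {C : Finset ι} {q r p K M : ℝ}
    (hq : 1 ≤ q) (hr : 1 ≤ r) (hK : 0 < K) (hM : 0 < M)
    (hcot : ∀ (N : ℕ) (y : Fin N → Y),
      (∑ i, ‖y i‖ ^ q) ^ (1 / q) ≤ ∑ ε, K / 2 ^ N * ‖signedSum ε y‖)
    (hT : ∀ (N : ℕ) (x : ∀ j, ℕ → X j) (z : ∀ j, X j),
      (∀ j ∈ C, weakNorm 𝕜 p (x j) ≤ 1) → (∀ j ∉ C, ‖z j‖ ≤ 1) →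
      ∑ i : {a // a ∈ C} → Fin N, ‖T (blockArg C x i z)‖ ^ r ≤ M ^ r)
    (N : ℕ) (x : ∀ j, ℕ → X j) (hx : ∀ j ∈ C, weakNorm 𝕜 p (x j) ≤ 1)
    (hs : ∀ j ∉ C, ∀ ε : Fin (N + 1) → Bool, ‖signedSum ε (fun s => x j s)‖ ≤ 1) :
    ∑ v, fiberSum (restrictTo C) (fun i : ι → Fin (N + 1) => ‖T fun j => x j (i j)‖ ^ q) v
      ^ (r / q) ≤ (K ^ (Cᶜ).card * M) ^ r := by
  refine le_trans (le_of_eq ?_) (sum_boxOver_le hq hr hK hM hcot hT N x hx Cᶜ (by simp)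
    (fun j hj => hs j (by simpa using hj)) 0 (by simp))
  refine Finset.sum_congr rfl fun v _ => ?_
  congr 1
  unfold fiberSum
  refine Finset.sum_congr ?_ fun i _ => ?_
  · ext i
    simp only [Finset.mem_filter, Finset.mem_univ, true_and, mem_boxOver, Finset.mem_compl]
    constructor
    · rintro rfl
      exact ⟨fun j h => rfl, fun j h h' => absurd h h'⟩
    · rintro ⟨h, _⟩
      exact funext fun j => h j j.2
  · have : mixedArg C Cᶜ x i 0 = fun j => x j (i j) := by
      ext j
      by_cases h : j ∈ C <;> simp [mixedArg, h]
    rw [this]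

end CotypeEstimate

/-! ### Normalization, weighted estimates and exponents. -/

section Assembly

variable {𝕜 : Type*} [RCLike 𝕜] {ι : Type*} [Fintype ι] [DecidableEq ι]
  {X : ι → Type*} [∀ j, NormedAddCommGroup (X j)] [∀ j, NormedSpace 𝕜 (X j)]
  {Y : Type*} [NormedAddCommGroup Y] [NormedSpace 𝕜 Y]

lemma tsum_le_of_sum_box_le {f : (ι → ℕ) → ℝ≥0∞} {B : ℝ≥0∞}
    (h : ∀ N : ℕ, ∑ i : ι → Fin (N + 1), f (fun j => i j) ≤ B) : ∑' i, f i ≤ B := by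
  rw [ENNReal.tsum_eq_iSup_sum]
  refine iSup_le fun S => ?_
  let N := S.sup fun i => Finset.univ.sup i
  have hN : ∀ i ∈ S, ∀ j, i j < N + 1 := fun i hi j => Nat.lt_succ_of_le <|
    (Finset.le_sup (f := i) (Finset.mem_univ j)).trans
      (Finset.le_sup (f := fun i : ι → ℕ => Finset.univ.sup i) hi)
  let e : (ι → Fin (N + 1)) ↪ (ι → ℕ) :=
    ⟨fun i j => i j, fun i i' hi => funext fun j => Fin.ext (congrFun hi j)⟩
  have hS : S ⊆ Finset.univ.map e := fun i hi => by
    rw [Finset.mem_map]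
    exact ⟨fun j => ⟨i j, hN i hi j⟩, Finset.mem_univ _, rfl⟩
  refine (Finset.sum_le_sum_of_subset hS).trans ?_
  rw [Finset.sum_map]
  exact h N

/-- It suffices to prove multiple summability for normalized sequences and finite boxes. -/
theorem isMultipleSumming_of_box {T : MultilinearMap 𝕜 X Y} {s K : ℝ} {p : ι → ℝ} (hs : 0 < s)
    (hp : ∀ j, 0 < p j) (hK : 0 < K)
    (h : ∀ (N : ℕ) (x : ∀ j, ℕ → X j), (∀ j, weakNorm 𝕜 (p j) (x j) ≤ 1) →
      ∑ i : ι → Fin (N + 1), ‖T fun j => x j (i j)‖ ^ s ≤ K ^ s) :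
    IsMultipleSumming s p T := by
  refine ⟨K, hK, fun x => ?_⟩
  -- Zero factors are excluded before infinite ones, because ∞ * 0 = 0 on the right side.
  by_cases h0 : ∃ j, weakNorm 𝕜 (p j) (x j) = 0
  · obtain ⟨j, hj⟩ := h0
    have : ∀ i : ι → ℕ, T (fun j => x j (i j)) = 0 := fun i =>
      T.map_coord_zero j (eq_zero_of_weakNorm_eq_zero (hp j) hj (i j))
    simp [this, hs]
  push Not at h0
  by_cases htop : ∃ j, weakNorm 𝕜 (p j) (x j) = ∞
  · obtain ⟨j, hj⟩ := htop
    have : ∏ j, weakNorm 𝕜 (p j) (x j) = ∞ := by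
      rw [← Finset.mul_prod_erase _ _ (Finset.mem_univ j), hj]
      exact ENNReal.top_mul (Finset.prod_ne_zero_iff.2 fun l _ => h0 l)
    rw [this, ENNReal.mul_top (by simpa using hK)]
    exact le_top
  push Not at htop
  set W : ι → ℝ := fun j => (weakNorm 𝕜 (p j) (x j)).toReal with hW
  have hWpos : ∀ j, 0 < W j := fun j => ENNReal.toReal_pos (h0 j) (htop j)
  have hWof : ∀ j, weakNorm 𝕜 (p j) (x j) = ENNReal.ofReal (W j) := fun j =>
    (ENNReal.ofReal_toReal (htop j)).symm
  have hPpos : 0 < ∏ j, W j := Finset.prod_pos fun j _ => hWpos j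
  have hprod : ENNReal.ofReal K * ∏ j, weakNorm 𝕜 (p j) (x j)
      = ENNReal.ofReal (K * ∏ j, W j) := by
    rw [ENNReal.ofReal_mul hK.le, ENNReal.ofReal_prod_of_nonneg fun j _ => (hWpos j).le]
    simp only [hWof]
  rw [hprod]
  have hx' : ∀ j, weakNorm 𝕜 (p j) (fun n => (((W j)⁻¹ : ℝ) : 𝕜) • x j n) ≤ 1 := fun j => by
    refine (weakNorm_smul_le (hp j) _ _).trans (le_of_eq ?_)
    rw [hWof, ← ofReal_norm, RCLike.norm_ofReal, abs_of_pos (inv_pos.2 (hWpos j)),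
      ← ENNReal.ofReal_mul (inv_pos.2 (hWpos j)).le, inv_mul_cancel₀ (hWpos j).ne',
      ENNReal.ofReal_one]
  have hbox : ∑' i : ι → ℕ, ‖T (fun j => x j (i j))‖ₑ ^ s
      ≤ ENNReal.ofReal ((K * ∏ j, W j) ^ s) := by
    refine tsum_le_of_sum_box_le fun N => ?_
    have h1 := h N (fun j n => (((W j)⁻¹ : ℝ) : 𝕜) • x j n) hx'
    have h2 : ∀ i : ι → Fin (N + 1), ‖T fun j => x j (i j)‖ ^ s
        = (∏ j, W j) ^ s * ‖T fun j => (((W j)⁻¹ : ℝ) : 𝕜) • x j (i j)‖ ^ s := by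
      intro i
      rw [T.map_smul_univ, norm_smul, ← Real.mul_rpow hPpos.le (by positivity), norm_prod]
      simp only [RCLike.norm_ofReal, abs_inv, abs_of_pos (hWpos _)]
      rw [Finset.prod_inv_distrib, mul_inv_cancel_left₀ hPpos.ne']
    calc ∑ i : ι → Fin (N + 1), ‖T (fun j => x j (i j))‖ₑ ^ s
        = ENNReal.ofReal (∑ i : ι → Fin (N + 1), ‖T fun j => x j (i j)‖ ^ s) := by
          rw [ENNReal.ofReal_sum_of_nonneg fun _ _ => by positivity]
          refine Finset.sum_congr rfl fun i _ => ?_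
          rw [← ENNReal.ofReal_rpow_of_nonneg (norm_nonneg _) hs.le, ofReal_norm]
      _ ≤ _ := by
          refine ENNReal.ofReal_le_ofReal ?_
          simp only [h2]
          rw [← Finset.mul_sum, mul_comm K, Real.mul_rpow hPpos.le hK.le]
          gcongr
  refine (ENNReal.rpow_le_rpow hbox (one_div_pos.2 hs).le).trans (le_of_eq ?_)
  rw [← ENNReal.ofReal_rpow_of_nonneg (by positivity) hs.le, ← ENNReal.rpow_mul,
    mul_one_div_cancel hs.ne', ENNReal.rpow_one]

variable {κ : Type*} [Fintype κ] [DecidableEq κ]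

/-- The marginal of a weight on multi-indices at the coordinate `j`. -/
def marginal {C : Finset ι} {N : ℕ} (u : ({a // a ∈ C} → Fin N) → ℝ) (j : {a // a ∈ C}) (n : ℕ) :
    ℝ :=
  ∑ w, if (w j : ℕ) = n then u w else 0

omit [Fintype ι] in
lemma marginal_nonneg {C : Finset ι} {N : ℕ} {u : ({a // a ∈ C} → Fin N) → ℝ}
    (hu : ∀ w, 0 ≤ u w) (j : {a // a ∈ C}) (n : ℕ) : 0 ≤ marginal u j n :=
  Finset.sum_nonneg fun w _ => by split_ifs <;> simp [hu]

omit [Fintype ι] in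
lemma le_marginal {C : Finset ι} {N : ℕ} {u : ({a // a ∈ C} → Fin N) → ℝ}
    (hu : ∀ w, 0 ≤ u w) (j : {a // a ∈ C}) (w : {a // a ∈ C} → Fin N) :
    u w ≤ marginal u j (w j) := by
  refine le_trans (le_of_eq (by simp)) (Finset.single_le_sum
    (f := fun w' => if (w' j : ℕ) = w j then u w' else 0) (fun w _ => ?_) (Finset.mem_univ w))
  split_ifs <;> simp [hu]

omit [Fintype ι] in
lemma sum_marginal {C : Finset ι} {N : ℕ} (u : ({a // a ∈ C} → Fin N) → ℝ) (j : {a // a ∈ C}) :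
    ∑ s : Fin N, marginal u j s = ∑ w, u w := by
  unfold marginal
  rw [Finset.sum_comm]
  refine Finset.sum_congr rfl fun w _ => ?_
  simp [Fin.val_inj]

/-- The weighted mixed norm estimates satisfied by the array `‖T x_i‖`. -/
theorem weighted_mixed_estimate {T : MultilinearMap 𝕜 X Y} {C : κ → Finset ι} {blk : ι → κ}
    (hblk : ∀ j k, j ∈ C k ↔ blk j = k) {q M : ℝ} {r p : κ → ℝ} (hq : 1 ≤ q)
    (hr : ∀ k, 1 ≤ r k) (hp : ∀ k, 1 ≤ p k) (hM : 0 < M)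
    (hT : ∀ k (N : ℕ) (x : ∀ j, ℕ → X j), (∀ j ∈ C k, weakNorm 𝕜 (p k) (x j) ≤ 1) →
      (∀ j ∉ C k, ∀ ε : Fin (N + 1) → Bool, ‖signedSum ε (fun s => x j s)‖ ≤ 1) →
      ∑ v, fiberSum (restrictTo (C k)) (fun i : ι → Fin (N + 1) => ‖T fun j => x j (i j)‖ ^ q) v
        ^ (r k / q) ≤ M ^ r k)
    {N : ℕ} {x : ∀ j, ℕ → X j} (hx : ∀ j, weakNorm 𝕜 (p (blk j)) (x j) ≤ 1)
    (u : ∀ k, ({a // a ∈ C k} → Fin (N + 1)) → ℝ) (hu : ∀ k v, 0 ≤ u k v)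
    (hu1 : ∀ k, ∑ v, u k v ≤ 1) (k : κ) :
    ∑ v, fiberSum (restrictTo (C k)) (fun i : ι → Fin (N + 1) =>
      (∏ l, u l (restrictTo (C l) i) ^ (q * (C l).card * invConj (p l)))
        * (‖T fun j => x j (i j)‖ / M) ^ q) v
      ^ (1 / (1 + -blockFactor q (r k) (p k) (C k).card)) ≤ 1 := by
  have hq0 : 0 < q := by linarith
  have hr0 : 0 < r k := by linarith [hr k]
  have hmem : ∀ j, j ∈ C (blk j) := fun j => (hblk j _).2 rfl
  have hcj := fun l => invConj_nonneg (hp l)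
  set U : ι → ℕ → ℝ := fun j => marginal (u (blk j)) ⟨j, hmem j⟩ with hU
  have hU0 : ∀ j n, 0 ≤ U j n := fun j n => marginal_nonneg (hu _) _ _
  -- The vectors of the block k are left alone. Elsewhere the marginals of u, of mass at most 1,
  -- give the ℓ^{p^*} weights that keep signed sums in the unit ball.
  set a : ι → ℕ → ℝ := fun j n => if blk j = k then 1 else U j n ^ invConj (p (blk j)) with ha
  have ha0 : ∀ j n, 0 ≤ a j n := fun j n => by
    simp only [ha]
    split_ifs
    · exact zero_le_one
    · exact Real.rpow_nonneg (hU0 _ _) _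
  have hTk := hT k N (fun j n => (a j n : 𝕜) • x j n)
    (fun j hj => by
      have hb := (hblk j k).1 hj
      have := hx j
      rw [hb] at this
      simpa [ha, hb] using this)
    (fun j hj ε => by
      have hb : blk j ≠ k := fun h => hj ((hblk j k).2 h)
      simp only [ha, if_neg hb]
      refine norm_signedSum_le_one (hp _) (hx j) (hU0 j) ?_ ε
      exact (sum_marginal _ _).trans_le (hu1 _))
  set d : (ι → Fin (N + 1)) → ℝ := fun i => ∏ l ∈ Finset.univ.erase k,
    u l (restrictTo (C l) i) ^ (q * (C l).card * invConj (p l)) with hd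
  have hd0 : ∀ i, 0 ≤ d i := fun i => Finset.prod_nonneg fun l _ => Real.rpow_nonneg (hu _ _) _
  -- A weight is dominated by each of its marginals, hence u^|C_l| by their product over C_l.
  have hda : ∀ i : ι → Fin (N + 1), d i ≤ (∏ j, a j (i j)) ^ q := by
    intro i
    rw [← Real.finsetProd_rpow _ _ fun j _ => ha0 _ _,
      ← Finset.prod_fiberwise Finset.univ blk, ← Finset.mul_prod_erase _ _ (Finset.mem_univ k)]
    have h1 : ∏ j with blk j = k, a j (i j) ^ q = 1 := by
      refine Finset.prod_eq_one fun j hj => ?_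
      simp [ha, (Finset.mem_filter.1 hj).2]
    rw [h1, one_mul]
    refine Finset.prod_le_prod (fun l _ => Real.rpow_nonneg (hu _ _) _) fun l hl => ?_
    have hlk := (Finset.mem_erase.1 hl).1
    have hfilter : Finset.univ.filter (fun j => blk j = l) = C l := by
      ext j
      simp [hblk]
    rw [hfilter]
    calc u l (restrictTo (C l) i) ^ (q * (C l).card * invConj (p l))
        = ∏ j ∈ C l, u l (restrictTo (C l) i) ^ (invConj (p l) * q) := by
          rw [Finset.prod_const, ← Real.rpow_natCast, ← Real.rpow_mul (hu _ _)]
          congr 1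
          ring
      _ ≤ ∏ j ∈ C l, a j (i j) ^ q := by
          refine Finset.prod_le_prod (fun j _ => Real.rpow_nonneg (hu _ _) _) fun j hj => ?_
          obtain rfl := (hblk j l).1 hj
          simp only [ha, if_neg hlk]
          rw [← Real.rpow_mul (hU0 _ _)]
          refine Real.rpow_le_rpow (hu _ _) ?_ (mul_nonneg (hcj _) hq0.le)
          exact le_marginal (hu _) ⟨j, hmem j⟩ (restrictTo (C (blk j)) i)
  have hTa : ∀ i : ι → Fin (N + 1), ‖T fun j => (a j (i j) : 𝕜) • x j (i j)‖
      = (∏ j, a j (i j)) * ‖T fun j => x j (i j)‖ := by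
    intro i
    rw [T.map_smul_univ, norm_smul, norm_prod]
    simp only [RCLike.norm_ofReal, abs_of_nonneg (ha0 _ _)]
  set b : (ι → Fin (N + 1)) → ℝ := fun i => d i * (‖T fun j => x j (i j)‖ / M) ^ q with hb
  have hb0 : ∀ i, 0 ≤ b i := fun i => mul_nonneg (hd0 i) (by positivity)
  have hF0 := fiberSum_nonneg (restrictTo (C k)) hb0
  have hF : ∑ v, fiberSum (restrictTo (C k)) b v ^ (r k / q) ≤ 1 := by
    have h1 : ∀ v, fiberSum (restrictTo (C k)) b v ≤ (M ^ q)⁻¹ * fiberSum (restrictTo (C k))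
        (fun i : ι → Fin (N + 1) => ‖T fun j => (a j (i j) : 𝕜) • x j (i j)‖ ^ q) v := by
      intro v
      unfold fiberSum
      rw [Finset.mul_sum]
      refine Finset.sum_le_sum fun i _ => ?_
      have hpa : 0 ≤ ∏ j, a j (i j) := Finset.prod_nonneg fun j _ => ha0 _ _
      rw [hTa, Real.mul_rpow hpa (norm_nonneg _), hb]
      simp only
      rw [Real.div_rpow (norm_nonneg _) hM.le]
      calc d i * (‖T fun j => x j (i j)‖ ^ q / M ^ q)
          ≤ (∏ j, a j (i j)) ^ q * (‖T fun j => x j (i j)‖ ^ q / M ^ q) := by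
            gcongr
            exact hda i
        _ = _ := by ring
    calc ∑ v, fiberSum (restrictTo (C k)) b v ^ (r k / q)
        ≤ ∑ v, (M ^ r k)⁻¹ * fiberSum (restrictTo (C k))
          (fun i : ι → Fin (N + 1) => ‖T fun j => (a j (i j) : 𝕜) • x j (i j)‖ ^ q) v
            ^ (r k / q) := by
          refine Finset.sum_le_sum fun v _ => ?_
          refine (Real.rpow_le_rpow (hF0 v) (h1 v) (by positivity)).trans (le_of_eq ?_)
          rw [Real.mul_rpow (by positivity) (fiberSum_nonneg _ (fun i => by positivity) _),
            Real.inv_rpow (by positivity), ← Real.rpow_mul hM.le, mul_div_cancel₀ _ hq0.ne']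
      _ ≤ (M ^ r k)⁻¹ * M ^ r k := by
          rw [← Finset.mul_sum]
          gcongr
      _ = 1 := inv_mul_cancel₀ (by positivity)
  set c := q * (C k).card * invConj (p k) with hc
  have hc0 : 0 ≤ c := mul_nonneg (by positivity) (hcj k)
  have hden : 1 + -blockFactor q (r k) (p k) (C k).card = q / r k + c := by
    rw [blockFactor]; ring
  rw [hden]
  have hpos : 0 < q / r k := by positivity
  have hterm : ∀ v, fiberSum (restrictTo (C k)) (fun i : ι → Fin (N + 1) =>
      (∏ l, u l (restrictTo (C l) i) ^ (q * (C l).card * invConj (p l)))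
        * (‖T fun j => x j (i j)‖ / M) ^ q) v ^ (1 / (q / r k + c))
      ≤ c / (q / r k + c) * u k v
        + q / r k / (q / r k + c) * fiberSum (restrictTo (C k)) b v ^ (r k / q) := by
    intro v
    have h1 : (fun i : ι → Fin (N + 1) =>
        (∏ l, u l (restrictTo (C l) i) ^ (q * (C l).card * invConj (p l)))
        * (‖T fun j => x j (i j)‖ / M) ^ q) = fun i => u k (restrictTo (C k) i) ^ c * b i := by
      ext i
      rw [← Finset.mul_prod_erase _ _ (Finset.mem_univ k), mul_assoc]
    rw [h1, fiberSum_mul_comp (restrictTo (C k)) (fun v => u k v ^ c),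
      Real.mul_rpow (Real.rpow_nonneg (hu _ _) _) (hF0 v), ← Real.rpow_mul (hu _ _)]
    -- The weight of block k is constant on fibers and enters only here; the AM-GM weights produce
    -- the exponent 1/(q/r_k + c).
    have h2 := Real.geom_mean_le_arith_mean2_weighted (w₁ := c / (q / r k + c))
      (w₂ := q / r k / (q / r k + c)) (by positivity) (by positivity) (hu k v)
      (Real.rpow_nonneg (hF0 v) (r k / q)) (by field_simp; ring)
    rw [← Real.rpow_mul (hF0 v)] at h2
    convert h2 using 3
    · ring
    · field_simp
  calc _ ≤ ∑ v, (c / (q / r k + c) * u k v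
        + q / r k / (q / r k + c) * fiberSum (restrictTo (C k)) b v ^ (r k / q)) :=
        Finset.sum_le_sum fun v _ => hterm v
    _ = c / (q / r k + c) * ∑ v, u k v
        + q / r k / (q / r k + c) * ∑ v, fiberSum (restrictTo (C k)) b v ^ (r k / q) := by
        rw [Finset.sum_add_distrib, Finset.mul_sum, Finset.mul_sum]
    _ ≤ c / (q / r k + c) * 1 + q / r k / (q / r k + c) * 1 := by
        gcongr
        exact hu1 k
    _ = 1 := by field_simp; ring

/-- The exponents `γ_k` in terms of the block factors. -/
lemma div_exponent_eq {q : ℝ} (hq : 0 < q) {r p : κ → ℝ} (N : κ → ℕ)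
    (hθ : ∀ k, blockFactor q (r k) (p k) (N k) < 0) {γ : κ → ℝ} {k : κ}
    (hγ : 1 / γ k = 1 / r k - ∑ j ∈ Finset.univ.filter (fun j => j ≠ k), (N j : ℝ) * invConj (p j) *
        (blockFactor q (r k) (p k) (N k) / blockFactor q (r j) (p j) (N j))) :
    q / γ k = 1 + -blockFactor q (r k) (p k) (N k) *
      (1 - ∑ l, q * N l * invConj (p l) / -blockFactor q (r l) (p l) (N l)) := by
  rw [div_eq_mul_one_div, hγ, Finset.filter_ne',
    ← Finset.add_sum_erase _ _ (Finset.mem_univ k)]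
  have hk := (hθ k).ne
  set F := blockFactor q (r k) (p k) (N k) with hF
  have h1 : ∑ j ∈ Finset.univ.erase k, (N j : ℝ) * invConj (p j) *
      (F / blockFactor q (r j) (p j) (N j))
      = -(F / q) * ∑ l ∈ Finset.univ.erase k,
        q * N l * invConj (p l) / -blockFactor q (r l) (p l) (N l) := by
    rw [Finset.mul_sum]
    refine Finset.sum_congr rfl fun j _ => ?_
    have := (hθ j).ne
    field_simp
  rw [h1]
  generalize ∑ l ∈ Finset.univ.erase k,
    q * N l * invConj (p l) / -blockFactor q (r l) (p l) (N l) = S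
  -- The term l = k of the full sum takes c_k away from 1 + θ_k and leaves q / r_k; this is why the
  -- sum defining γ_k omits k.
  have h2 : q * N k * invConj (p k) = 1 - q / r k - F := by rw [hF, blockFactor]; ring
  rw [h2]
  field_simp
  ring

end Assembly

/-! ### Proof of the theorem. -/

theorem theorem2p1 {𝕜 : Type*} [RCLike 𝕜]
    (m n : ℕ) (hm : 2 ≤ m) (hn : 2 ≤ n)
    (X : Fin m → Type*) [∀ j, NormedAddCommGroup (X j)] [∀ j, NormedSpace 𝕜 (X j)]
    [∀ j, CompleteSpace (X j)]
    (Y : Type*) [NormedAddCommGroup Y] [NormedSpace 𝕜 Y] [CompleteSpace Y]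
    -- the partition of the coordinates into non-empty blocks
    (C : Fin n → Finset (Fin m))
    (hC_ne : ∀ k, (C k).Nonempty)
    (hC_disj : ∀ k l, k ≠ l → Disjoint (C k) (C l))
    (hC_cover : ∀ j, ∃ k, j ∈ C k)
    (q : ℝ) (hq : HasCotype Y q)
    (r p : Fin n → ℝ)
    (hr : ∀ k, 1 ≤ r k ∧ r k < q) (hp : ∀ k, 1 ≤ p k)
    -- the exponents
    (γ : Fin n → ℝ)
    (hγ : ∀ k, 1 / γ k = 1 / r k - ∑ j ∈ Finset.univ.filter (fun j => j ≠ k),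
      ((C j).card : ℝ) * invConj (p j) *
        (blockFactor q (r k) (p k) (C k).card / blockFactor q (r j) (p j) (C j).card))
    (γ₂ : Fin n → Fin n → ℝ)
    (hγ₂ : ∀ k l, k ≠ l →
      1 / γ₂ k l = 1 / r k - ∑ j ∈ Finset.univ.filter (fun j => j ≠ k ∧ j ≠ l),
        ((C j).card : ℝ) * invConj (p j) *
          (blockFactor q (r k) (p k) (C k).card / blockFactor q (r j) (p j) (C j).card))
    (R : ℝ) (hR : R = ∑ k, γ k / (q - γ k))
    (s : ℝ) (hs : s = q * R / (1 + R))
    (qv : Fin m → ℝ) (hqv : ∀ k, ∀ j ∈ C k, qv j = p k)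
    -- the positivity and size conditions
    (hγ_pos : ∀ k, 0 < γ k) (hγ_lt : ∀ k, γ k < q)
    (hγ₂_range : ∀ k l, k ≠ l → 0 < γ₂ k l ∧ γ₂ k l ≤ q)
    (hγ₂_size : ∀ k l, k ≠ l → ((C l).card : ℝ) * γ₂ k l * invConj (p l) ≤ 1)
    (T : MultilinearMap 𝕜 X Y)
    (hT : ∀ k, IsCoordinatewiseSumming (C k) (r k) (p k) T) :
    IsMultipleSumming s qv T := by
  have hq0 : 0 < q := by linarith [hq.1]
  have hq1 : 1 ≤ q := by linarith [hq.1]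
  have hne : Nonempty (Fin n) := ⟨⟨0, by omega⟩⟩
  choose blk hmem using hC_cover
  have hblk : ∀ j k, j ∈ C k ↔ blk j = k := fun j k =>
    ⟨fun h => by
      by_contra hjk
      exact Finset.disjoint_left.1 (hC_disj _ _ hjk) (hmem j) h, fun h => h ▸ hmem j⟩
  have hcont : ∀ y j, Continuous (T.toLinearMap y j) := fun y j =>
    (hT (blk j)).continuous_update (by linarith [(hr (blk j)).1]) (by linarith [hp (blk j)])
      (hmem j) y
  let _ : NormedSpace ℝ Y := NormedSpace.restrictScalars ℝ 𝕜 Y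
  obtain ⟨K, hK, hcot⟩ := hq.exists_first_moment
  choose M hM hTM using fun k => (hT k).exists_uniform_bound hcont (hr k).1
  -- a constant which serves all blocks
  set A : ℝ := ∑ k, K ^ ((C k)ᶜ).card * M k with hA
  have hterm : ∀ k, 0 < K ^ ((C k)ᶜ).card * M k := fun k => mul_pos (pow_pos hK _) (hM k)
  have hApos : 0 < A := Finset.sum_pos (fun k _ => hterm k) Finset.univ_nonempty
  have hAle : ∀ k, K ^ ((C k)ᶜ).card * M k ≤ A := fun k =>
    Finset.single_le_sum (f := fun k => K ^ ((C k)ᶜ).card * M k) (fun k _ => (hterm k).le)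
      (Finset.mem_univ k)
  have hθ : ∀ k, blockFactor q (r k) (p k) (C k).card < 0 := fun k => by
    have h1 : 1 < q / r k := (one_lt_div (by linarith [(hr k).1])).2 (hr k).2
    have h2 : 0 ≤ q * (C k).card * invConj (p k) :=
      mul_nonneg (by positivity) (invConj_nonneg (hp k))
    rw [blockFactor]
    linarith
  have hexp := fun k => div_exponent_eq hq0 (fun k => (C k).card) hθ (hγ k)
  set S := ∑ l, q * (C l).card * invConj (p l) / -blockFactor q (r l) (p l) (C l).card with hS
  -- By `hexp`, γ_k < q says that θ_k (1 - S) > 0, and θ_k > 0.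
  have hS1 : S < 1 := by
    obtain ⟨k⟩ := hne
    have h1 : 1 < q / γ k := (one_lt_div (hγ_pos k)).2 (hγ_lt k)
    rw [hexp k] at h1
    have := hθ k
    by_contra hcon
    push Not at hcon
    nlinarith
  have hRpos : 0 < R := hR ▸ Finset.sum_pos
    (fun k _ => div_pos (hγ_pos k) (sub_pos.2 (hγ_lt k))) Finset.univ_nonempty
  have hs0 : 0 < s := by rw [hs]; positivity
  refine isMultipleSumming_of_box hs0 (fun j => ?_) hApos fun N x hx => ?_
  · rw [hqv _ j (hmem j)]
    linarith [hp (blk j)]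
  have hest := weighted_mixed_estimate hblk hq1 (fun k => (hr k).1) hp hApos
    (fun k N x h1 h2 => (sum_fiberSum_restrictTo_le hq1 (hr k).1 hK (hM k) hcot (hTM k) N x h1
      h2).trans (Real.rpow_le_rpow (hterm k).le (hAle k) (by linarith [(hr k).1])))
    (N := N) (x := x) (fun j => hqv _ j (hmem j) ▸ hx j)
  have hb : ∀ i : Fin m → Fin (N + 1), 0 ≤ (‖T fun j => x j (i j)‖ / A) ^ q := fun i => by
    positivity
  have hmix := sum_rpow_fiberSum_le_one_of_weighted (fun k => restrictTo (C k)) hb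
    (c := fun k => q * (C k).card * invConj (p k))
    (θ := fun k => -blockFactor q (r k) (p k) (C k).card)
    (fun k => mul_nonneg (by positivity) (invConj_nonneg (hp k)))
    (fun k => neg_pos.2 (hθ k)) hS1 hest
  have hfin := sum_rpow_le_one_of_fiberSum (fun k => restrictTo (C k))
    (fun i i' h => funext fun j => congrFun (congrFun h (blk j)) ⟨j, hmem j⟩) hb
    (e := fun k => γ k / q) (fun k => div_pos (hγ_pos k) hq0)
    (fun k => (div_lt_one hq0).2 (hγ_lt k))
    (fun k => by
      have h1 := hmix k
      rw [← hS, ← hexp k, one_div_div] at h1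
      exact h1)
    (R := R) (by
      rw [hR]
      refine Finset.sum_congr rfl fun k _ => ?_
      have := sub_pos.2 (hγ_lt k)
      field_simp)
  have hpow : ∀ i : Fin m → Fin (N + 1), ‖T fun j => x j (i j)‖ ^ s
      = A ^ s * ((‖T fun j => x j (i j)‖ / A) ^ q) ^ (R / (1 + R)) := fun i => by
    rw [← Real.rpow_mul (by positivity), ← mul_div_assoc, ← hs,
      ← Real.mul_rpow hApos.le (by positivity), mul_div_cancel₀ _ hApos.ne']
  simp only [hpow]
  rw [← Finset.mul_sum]
  exact mul_le_of_le_one_right (by positivity) hfin
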